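/- Let $K\ge 1$ and $\alpha>2$. A homeomorphism $\varphi:\Omega\to\widetilde\Omega$ between planar domains is called $K$-quasiconformal if $\varphi\in W^1_{2,\mathrm{loc}}(\Omega)$ and $|D\varphi(x)|^2\le K\,|J(x,\varphi)|$ for almost every $x\in\Omega$, where $D\varphi$ is the matrix of weak partial derivatives, $|D\varphi|$ its operator norm and $J(x,\varphi)=\det D\varphi(x)$. A simply connected domain $\Omega\subset\mathbb R^2$ is called $K$-quasiconformal $\alpha$-regular if there is a $K$-quasiconformal homeomorphism $\varphi$ of $\Omega$ onto the unit disc $\mathbb D$ with $$\int_{\mathbb D}|J(y,\varphi^{-1})|^{\alpha/2}\,dy<\infty .$$ Let $\Omega$ be a $K$-quasiconformal $\alpha$-regular domain, let $\varphi:\Omega\to\mathbb D$ be any $K$-quasiconformal homeomorphism onto $\mathbb D$ for which this integral is finite, and let $h(x)=|J(x,\varphi)|$. Let $\alpha/(\alpha-2)\le r<\infty$ and $s=\frac{\alpha-2}{\alpha}\,r$. Then every measurable $f:\Omega\to\mathbb R$ with $$\|f\|_{L_r(\Omega,h)}=\Big(\int_\Omega|f(x)|^r h(x)\,dx\Big)^{1/r}<\infty$$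 belongs to $L_s(\Omega)$, and $$\|f\|_{L_s(\Omega)}\le\Big(\int_{\mathbb D}|J(y,\varphi^{-1})|^{\alpha/2}\,dy\Big)^{\frac{2}{\alpha}\cdot\frac1s}\,\|f\|_{L_r(\Omega,h)} .$$ -/

import Mathlib

open MeasureTheory
open scoped ENNReal ContDiff

/-!
Planar domains are subsets of `ℂ`, regarded as the Euclidean plane `ℝ²`: the norm of `ℂ` is the
Euclidean one, `volume` is Lebesgue measure, derivatives are real-linear maps `ℂ →L[ℝ] ℂ` with the
operator norm, and `ContinuousLinearMap.det` is their determinant over `ℝ`.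
-/

namespace PlanarQC

noncomputable section

/-- `D` is a weak differential of `u` on the open set `U`: both are locally integrable on `U`, and
`∫_U ∂_v η · u = - ∫_U η · D v` for every test function `η ∈ C_c^∞(U)` and every direction `v`. -/
structure HasWeakFDeriv (U : Set ℂ) (u : ℂ → ℂ) (D : ℂ → ℂ →L[ℝ] ℂ) : Prop where
  locallyIntegrableOn : LocallyIntegrableOn u U
  locallyIntegrableOn_deriv : LocallyIntegrableOn D U
  integral_eq : ∀ η : ℂ → ℝ, ContDiff ℝ ∞ η → HasCompactSupport η → tsupport η ⊆ U →
    ∀ v : ℂ, ∫ x in U, (fderiv ℝ η x v) • u x = - ∫ x in U, η x • D x v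

/-- `u` is weakly differentiable on `U`. -/
def WeaklyDifferentiableOn (U : Set ℂ) (u : ℂ → ℂ) : Prop :=
  ∃ D : ℂ → ℂ →L[ℝ] ℂ, HasWeakFDeriv U u D

open Classical in
/-- The weak differential of `u` on `U` (the formal Jacobi matrix), determined almost everywhere
on `U` when `u` is weakly differentiable on `U`; by convention `0` otherwise. -/
def weakFDeriv (U : Set ℂ) (u : ℂ → ℂ) : ℂ → ℂ →L[ℝ] ℂ :=
  if h : WeaklyDifferentiableOn U u then h.choose else 0

/-- The Jacobian `J(x, u)`, the determinant of the formal Jacobi matrix of `u` on `U`. -/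
def jacobian (U : Set ℂ) (u : ℂ → ℂ) (x : ℂ) : ℝ :=
  (weakFDeriv U u x).det

/-- The local Sobolev class `W^1_{p,loc}(U)` of maps `U → ℝ²`. -/
structure MemSobolevLoc (U : Set ℂ) (p : ℝ≥0∞) (u : ℂ → ℂ) : Prop where
  weaklyDifferentiableOn : WeaklyDifferentiableOn U u
  memLp : ∀ C : Set ℂ, IsCompact C → C ⊆ U → MemLp u p (volume.restrict C)
  memLp_deriv : ∀ C : Set ℂ, IsCompact C → C ⊆ U →
    MemLp (weakFDeriv U u) p (volume.restrict C)

/-- The homeomorphism `φ`, from the open set `φ.source` onto the open set `φ.target`, is a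
`K`-quasiconformal mapping: it lies in `W^1_{2,loc}` and `|Dφ|² ≤ K |J(·, φ)|` almost everywhere. -/
structure IsQuasiconformal (K : ℝ) (φ : OpenPartialHomeomorph ℂ ℂ) : Prop where
  one_le : 1 ≤ K
  memSobolevLoc : MemSobolevLoc φ.source 2 φ
  distortion : ∀ᵐ x ∂(volume.restrict φ.source),
    ‖weakFDeriv φ.source φ x‖ ^ 2 ≤ K * |jacobian φ.source φ x|

/-- The open unit disc. -/
abbrev unitDisc : Set ℂ := Metric.ball 0 1

/-- The integral `∫_𝔻 |J(y, φ⁻¹)|^{α/2} dy` of a homeomorphism `φ` onto the unit disc. -/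
def inverseJacobianIntegral (α : ℝ) (φ : OpenPartialHomeomorph ℂ ℂ) : ℝ≥0∞ :=
  ∫⁻ y in unitDisc, ENNReal.ofReal (|jacobian unitDisc φ.symm y| ^ (α / 2))

/-- `φ : Ω → 𝔻` is a `K`-quasiconformal mapping with `∫_𝔻 |J(y, φ⁻¹)|^{α/2} dy < ∞`. -/
structure IsRegularMap (K α : ℝ) (Ω : Set ℂ) (φ : OpenPartialHomeomorph ℂ ℂ) : Prop where
  source_eq : φ.source = Ω
  target_eq : φ.target = unitDisc
  isQuasiconformal : IsQuasiconformal K φ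
  integral_lt_top : inverseJacobianIntegral α φ < ⊤

/-- `K`-quasiconformal `α`-regular domains. -/
structure IsRegularDomain (K α : ℝ) (Ω : Set ℂ) : Prop where
  isOpen : IsOpen Ω
  isSimplyConnected : IsSimplyConnected Ω
  two_lt : 2 < α
  exists_map : ∃ φ : OpenPartialHomeomorph ℂ ℂ, IsRegularMap K α Ω φ

/-- The norm `(∫_Ω |f|^p v dx)^{1/p}` of the weighted Lebesgue space `L_p(Ω, v)`. -/
def weightedNorm (p : ℝ) (Ω : Set ℂ) (v : ℂ → ℝ) (f : ℂ → ℝ) : ℝ≥0∞ :=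
  (∫⁻ x in Ω, ENNReal.ofReal (|f x| ^ p * v x)) ^ (1 / p)

/-- Membership in the weighted Lebesgue space `L_p(Ω, v)`. -/
def MemWeightedLp (p : ℝ) (Ω : Set ℂ) (v : ℂ → ℝ) (f : ℂ → ℝ) : Prop :=
  AEStronglyMeasurable f (volume.restrict Ω) ∧ weightedNorm p Ω v f < ⊤

end

end PlanarQC

namespace PlanarQC

open Set Filter Topology Metric Convolution

noncomputable section

/-! Write `J` for the Jacobian of `φ`. Formally the estimate is Hölder's inequality after a
substitution: `∫_Ω |f|^s = ∫_Ω |f|^s |J|⁻¹ |J| = ∫_𝔻 |f ∘ φ⁻¹|^s |J(·, φ⁻¹)|`, and the exponents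
`α/(α-2)` and `α/2` split the last integral into the two factors of the bound, because `s · α/(α-2)
= r`. The work lies in the substitution, for which three facts are derived from the analytic
definition: `φ⁻¹` pushes Lebesgue measure on the disc to `|J| dx`, `J ≠ 0` almost everywhere, and
`J(·, φ⁻¹) = 1 / J(φ⁻¹(·), φ)`.

The starting point is that the Jacobian is a null Lagrangian: the field `adj (D x) v` is divergence
free in the weak sense. Smooth approximation in `W^1_2` turns this into an integration by parts for
`J · (∂_v F) ∘ φ` (`integral_mul_det_mul_fderiv_comp`). With weight `1` it says that the
distribution `F ↦ ∫ F(φ) J` has zero gradient, so it is a constant `c` times Lebesgue measure. Since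
`φ` is injective this localises: `J` has the sign of `c`, and `∫_E |J| = |c| · |φ(E)|`
(`exists_area_formula`).

It remains to see that `|c| = 1`. If `c = 0`, then `J = 0`, the distortion inequality forces `D =
0`, and `φ` would be constant on a ball. If `c ≠ 0`, smooth approximants of `φ` have a constant
nonzero degree over a small disc, hence cover it, and comparing areas yields `|c| ≥ 1`
(`one_le_abs_of_area_formula`). With linear weights the same integration by parts shows that `φ⁻¹`
is weakly differentiable with differential `inv (D (φ⁻¹ y))`, which is locally in `L²` by the
distortion inequality. So the area formula applies to `φ⁻¹` as well; its constant has modulus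
`1/|c|`, which gives `J ≠ 0` almost everywhere and `|c| ≤ 1` (`exists_ball_ae_det_ne_zero`). -/

/-! ### Real-linear maps of the plane -/

/-- The adjugate of a real-linear map of the plane. -/
def adj (A : ℂ →L[ℝ] ℂ) : ℂ →L[ℝ] ℂ :=
  ((A 1).re + (A Complex.I).im) • ContinuousLinearMap.id ℝ ℂ - A

theorem clm_apply (A : ℂ →L[ℝ] ℂ) (z : ℂ) : A z = z.re • A 1 + z.im • A Complex.I := by
  conv_lhs => rw [show z = z.re • (1 : ℂ) + z.im • Complex.I by
    apply Complex.ext <;> simp]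
  rw [map_add, map_smul, map_smul]

theorem det_eq (A : ℂ →L[ℝ] ℂ) :
    A.det = (A 1).re * (A Complex.I).im - (A 1).im * (A Complex.I).re := by
  rw [ContinuousLinearMap.det, ← LinearMap.det_toMatrix Complex.basisOneI, Matrix.det_fin_two]
  simp [LinearMap.toMatrix_apply, mul_comm]

theorem adj_apply (A : ℂ →L[ℝ] ℂ) (v : ℂ) :
    adj A v = ⟨v.re * (A Complex.I).im - v.im * (A Complex.I).re,
      (A 1).re * v.im - (A 1).im * v.re⟩ := by
  rw [adj, sub_apply, clm_apply A v]
  apply Complex.ext <;> simp <;> ring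

theorem apply_adj (A : ℂ →L[ℝ] ℂ) (v : ℂ) : A (adj A v) = A.det • v := by
  rw [adj_apply, clm_apply, det_eq]
  apply Complex.ext <;> simp <;> ring

theorem det_adj (A : ℂ →L[ℝ] ℂ) : (adj A).det = A.det := by
  rw [det_eq, det_eq, adj_apply, adj_apply]
  simp; ring

theorem continuous_adj : Continuous adj := by
  unfold adj; fun_prop

theorem continuous_det : Continuous (fun A : ℂ →L[ℝ] ℂ => A.det) := by
  simp_rw [det_eq]; fun_prop

theorem det_smul' (t : ℝ) (A : ℂ →L[ℝ] ℂ) : (t • A).det = t ^ 2 * A.det := by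
  rw [det_eq, det_eq]; simp; ring

theorem norm_apply_one_le (A : ℂ →L[ℝ] ℂ) : ‖A 1‖ ≤ ‖A‖ := by simpa using A.le_opNorm 1

theorem norm_apply_I_le (A : ℂ →L[ℝ] ℂ) : ‖A Complex.I‖ ≤ ‖A‖ := by
  simpa using A.le_opNorm Complex.I

/-- The trace contributes `2 ‖A‖` and `A` itself contributes `‖A‖`. The factor is crude, but only
finiteness of the resulting bounds matters later. -/
theorem norm_adj_le (A : ℂ →L[ℝ] ℂ) : ‖adj A‖ ≤ 3 * ‖A‖ := by
  unfold adj
  refine (norm_sub_le _ _).trans ?_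
  rw [norm_smul]
  have h1 : ‖(A 1).re + (A Complex.I).im‖ ≤ 2 * ‖A‖ := by
    refine (norm_add_le _ _).trans ?_
    have h1 := (Complex.abs_re_le_norm (A 1)).trans (norm_apply_one_le A)
    have h2 := (Complex.abs_im_le_norm (A Complex.I)).trans (norm_apply_I_le A)
    rw [Real.norm_eq_abs, Real.norm_eq_abs]
    linarith
  have h2 := ContinuousLinearMap.norm_id_le (𝕜 := ℝ) (E := ℂ)
  nlinarith [norm_nonneg (ContinuousLinearMap.id ℝ ℂ), norm_nonneg A,
    norm_nonneg ((A 1).re + (A Complex.I).im)]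

theorem abs_cross_le (z w : ℂ) : |z.re * w.im - z.im * w.re| ≤ ‖z‖ * ‖w‖ := by
  have h : z.re * w.im - z.im * w.re = ((starRingEnd ℂ) z * w).im := by simp; ring
  rw [h]
  exact (Complex.abs_im_le_norm _).trans (by simp)

theorem abs_det_sub_le (A B : ℂ →L[ℝ] ℂ) :
    |A.det - B.det| ≤ ‖A - B‖ * (‖A‖ + ‖B‖) := by
  -- The determinant is bilinear in the two columns, which are exchanged one at a time.
  have h : A.det - B.det = (((A - B) 1).re * (A Complex.I).im - ((A - B) 1).im * (A Complex.I).re)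
      + ((B 1).re * ((A - B) Complex.I).im - (B 1).im * ((A - B) Complex.I).re) := by
    rw [det_eq, det_eq]; simp; ring
  rw [h]
  refine (abs_add_le _ _).trans ?_
  have h1 := (abs_cross_le ((A - B) 1) (A Complex.I)).trans
    (mul_le_mul (norm_apply_one_le _) (norm_apply_I_le _) (norm_nonneg _) (norm_nonneg _))
  have h2 := (abs_cross_le (B 1) ((A - B) Complex.I)).trans
    (mul_le_mul (norm_apply_one_le _) (norm_apply_I_le _) (norm_nonneg _) (norm_nonneg _))
  linarith

theorem abs_det_le (A : ℂ →L[ℝ] ℂ) : |A.det| ≤ ‖A‖ ^ 2 := by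
  rw [det_eq, sq]
  exact (abs_cross_le _ _).trans
    (mul_le_mul (norm_apply_one_le _) (norm_apply_I_le _) (norm_nonneg _) (norm_nonneg _))

/-! ### Mollification in `L²` -/

/-- Translations form a continuous family of measure preserving maps, and composition with such a
family acts continuously on `L²`. -/
theorem tendsto_eLpNorm_translate_sub {E : Type*} [NormedAddCommGroup E] {g : ℂ → E}
    (hg : MemLp g 2 volume) :
    Tendsto (fun t : ℂ => eLpNorm (fun x => g (x - t) - g x) 2 volume) (𝓝 0) (𝓝 0) := by
  let G : C(ℂ × ℂ, ℂ) := ⟨fun p => p.2 - p.1, by fun_prop⟩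
  have hmp : ∀ t : ℂ, MeasurePreserving (G.curry t) volume volume := fun t =>
    measurePreserving_sub_right volume t
  have hc := ContinuousAt.compMeasurePreservingLp (E := E) (p := 2) (μ := volume) (ν := volume)
    (f := fun _ : ℂ => hg.toLp g) (g := fun t => G.curry t) (z := 0) continuousAt_const
    G.curry.continuous.continuousAt hmp (by simp)
  have h0 := tendsto_iff_edist_tendsto_0.1 hc.tendsto
  refine h0.congr fun t => ?_
  rw [Lp.edist_def]
  refine eLpNorm_congr_ae ?_
  have e1 : ∀ t, ⇑(Lp.compMeasurePreserving (G.curry t) (hmp t) (hg.toLp g)) =ᵐ[volume]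
      fun x => g (x - t) := fun t =>
    (Lp.coeFn_compMeasurePreserving _ (hmp t)).trans
      ((hmp t).quasiMeasurePreserving.ae_eq_comp hg.coeFn_toLp)
  filter_upwards [e1 t, e1 0] with x h1 h2
  rw [Pi.sub_apply, h1, h2, sub_zero]

theorem eLpNorm_two_sq {α E : Type*} [MeasurableSpace α] [NormedAddCommGroup E] (μ : Measure α)
    (g : α → E) : eLpNorm g 2 μ ^ (2 : ℝ) = ∫⁻ x, ‖g x‖ₑ ^ (2 : ℝ) ∂μ := by
  rw [eLpNorm_eq_lintegral_rpow_enorm_toReal (by simp) (by simp)]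
  simp only [ENNReal.toReal_ofNat]
  rw [← ENNReal.rpow_mul]; norm_num

/-- The difference `ρ ⋆ g - g` is an average of `g(· - t) - g` over the probability measure `ρ dt`.
Cauchy–Schwarz for that measure moves the square inside, and Tonelli reduces to a single translate.
-/
theorem eLpNorm_normed_convolution_sub_le {E : Type*} [NormedAddCommGroup E] [NormedSpace ℝ E]
    [CompleteSpace E] {g : ℂ → E} (hg : MemLp g 2 volume) (ρ : ContDiffBump (0 : ℂ)) {ε : ℝ≥0∞}
    (h : ∀ t ∈ ball (0 : ℂ) ρ.rOut, eLpNorm (fun x => g (x - t) - g x) 2 volume ≤ ε) :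
    eLpNorm (fun x => (ρ.normed volume ⋆[ContinuousLinearMap.lsmul ℝ ℝ, volume] g) x - g x) 2
      volume ≤ ε := by
  have hρm : Measurable (fun t => ENNReal.ofReal (ρ.normed volume t)) :=
    ENNReal.measurable_ofReal.comp ρ.continuous_normed.measurable
  have hρ1 : ∫⁻ t, ENNReal.ofReal (ρ.normed volume t) = 1 := by
    rw [← ofReal_integral_eq_lintegral_ofReal ρ.integrable_normed
      (Eventually.of_forall ρ.nonneg_normed), ρ.integral_normed, ENNReal.ofReal_one]
  have hloc : LocallyIntegrable g volume := hg.locallyIntegrable (by norm_num)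
  set μρ : Measure ℂ := volume.withDensity (fun t => ENNReal.ofReal (ρ.normed volume t)) with hμρ
  have hprob : IsProbabilityMeasure μρ := ⟨by rw [hμρ, withDensity_apply _ MeasurableSet.univ]; simpa⟩
  -- pointwise estimate
  have hpt : ∀ x, ‖(ρ.normed volume ⋆[ContinuousLinearMap.lsmul ℝ ℝ, volume] g) x - g x‖ₑ ^ (2 : ℝ)
      ≤ ∫⁻ t, ENNReal.ofReal (ρ.normed volume t) * ‖g (x - t) - g x‖ₑ ^ (2 : ℝ) := by
    intro x
    have hex : ConvolutionExistsAt (ρ.normed volume) g x (ContinuousLinearMap.lsmul ℝ ℝ) volume :=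
      ρ.hasCompactSupport_normed.convolutionExists_left _ ρ.continuous_normed hloc x
    have e1 : (ρ.normed volume ⋆[ContinuousLinearMap.lsmul ℝ ℝ, volume] g) x - g x
        = ∫ t, ρ.normed volume t • (g (x - t) - g x) := by
      simp_rw [smul_sub]
      rw [integral_sub]
      · rw [ρ.integral_normed_smul]; rfl
      · exact hex.integrable
      · exact ρ.integrable_normed.smul_const _
    have hm : AEMeasurable (fun t => ‖g (x - t) - g x‖ₑ) volume := by
      refine AEStronglyMeasurable.enorm ?_
      refine AEStronglyMeasurable.sub ?_ aestronglyMeasurable_const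
      exact hg.1.comp_quasiMeasurePreserving
        (Measure.measurePreserving_sub_left volume x).quasiMeasurePreserving
    have hm' : AEMeasurable (fun t => ‖g (x - t) - g x‖ₑ) μρ :=
      hm.mono_ac (withDensity_absolutelyContinuous _ _)
    have e2 : ‖∫ t, ρ.normed volume t • (g (x - t) - g x)‖ₑ
        ≤ ∫⁻ t, ‖g (x - t) - g x‖ₑ ∂μρ := by
      refine (enorm_integral_le_lintegral_enorm _).trans ?_
      rw [hμρ, lintegral_withDensity_eq_lintegral_mul₀ hρm.aemeasurable hm]
      refine lintegral_mono fun t => ?_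
      simp only [Pi.mul_apply]
      rw [enorm_smul, Real.enorm_of_nonneg (ρ.nonneg_normed t)]
    have e3 : (∫⁻ t, ‖g (x - t) - g x‖ₑ ∂μρ) ^ (2 : ℝ)
        ≤ ∫⁻ t, ‖g (x - t) - g x‖ₑ ^ (2 : ℝ) ∂μρ := by
      have := ENNReal.lintegral_mul_le_Lp_mul_Lq μρ Real.HolderConjugate.two_two hm'
        (aemeasurable_const (b := (1 : ℝ≥0∞)))
      simp only [Pi.mul_apply, mul_one, ENNReal.one_rpow, lintegral_one, measure_univ] at this
      calc _ ≤ ((∫⁻ t, ‖g (x - t) - g x‖ₑ ^ (2 : ℝ) ∂μρ) ^ (1 / 2 : ℝ)) ^ (2 : ℝ) := by gcongr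
        _ = _ := by rw [← ENNReal.rpow_mul]; norm_num
    rw [e1]
    refine ((ENNReal.rpow_le_rpow e2 (by norm_num)).trans e3).trans_eq ?_
    rw [hμρ, lintegral_withDensity_eq_lintegral_mul₀ hρm.aemeasurable (hm.pow_const _)]
    rfl
  have hmeas : AEMeasurable (fun p : ℂ × ℂ =>
      ENNReal.ofReal (ρ.normed volume p.2) * ‖g (p.1 - p.2) - g p.1‖ₑ ^ (2 : ℝ))
      (volume.prod volume) := by
    refine (hρm.comp measurable_snd).aemeasurable.mul (AEMeasurable.pow_const ?_ _)
    refine AEStronglyMeasurable.enorm (AEStronglyMeasurable.sub ?_ hg.1.comp_fst)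
    exact hg.1.comp_quasiMeasurePreserving (quasiMeasurePreserving_sub_of_right_invariant _ _)
  rw [← ENNReal.rpow_le_rpow_iff (z := 2) (by norm_num), eLpNorm_two_sq]
  calc _ ≤ ∫⁻ x, ∫⁻ t, ENNReal.ofReal (ρ.normed volume t) * ‖g (x - t) - g x‖ₑ ^ (2 : ℝ) :=
        lintegral_mono hpt
    _ = ∫⁻ t, ∫⁻ x, ENNReal.ofReal (ρ.normed volume t) * ‖g (x - t) - g x‖ₑ ^ (2 : ℝ) :=
        lintegral_lintegral_swap hmeas
    _ ≤ ∫⁻ t, ENNReal.ofReal (ρ.normed volume t) * ε ^ (2 : ℝ) := by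
        refine lintegral_mono fun t => ?_
        simp only
        rw [lintegral_const_mul' _ _ ENNReal.ofReal_ne_top, ← eLpNorm_two_sq]
        by_cases ht : t ∈ ball (0 : ℂ) ρ.rOut
        · gcongr; exact h t ht
        · have : ρ.normed volume t = 0 := by
            rw [← Function.notMem_support, ρ.support_normed_eq]; exact ht
          simp [this]
    _ = ε ^ (2 : ℝ) := by rw [lintegral_mul_const _ hρm, hρ1, one_mul]

/-! ### Smooth approximation of `W^1_2` maps. -/

theorem HasWeakFDeriv.integral_smul_indicator {U V : Set ℂ} {u : ℂ → ℂ} {D : ℂ → ℂ →L[ℝ] ℂ}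
    (hu : HasWeakFDeriv U u D) (hU : IsOpen U) (hVU : V ⊆ U) {η : ℂ → ℝ}
    (hη : ContDiff ℝ ∞ η) (hηc : HasCompactSupport η) (hηV : tsupport η ⊆ V) (w : ℂ) :
    ∫ x, fderiv ℝ η x w • V.indicator u x = - ∫ x, η x • V.indicator D x w := by
  have h := hu.integral_eq η hη hηc (hηV.trans hVU) w
  have e1 : ∀ x, fderiv ℝ η x w • V.indicator u x
      = U.indicator (fun x => fderiv ℝ η x w • u x) x := by
    intro x
    by_cases hx : x ∈ V
    · rw [indicator_of_mem hx, indicator_of_mem (hVU hx)]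
    · have h0 : fderiv ℝ η x = 0 :=
        image_eq_zero_of_notMem_tsupport fun h' => hx (hηV (tsupport_fderiv_subset ℝ h'))
      simp [hx, h0, indicator]
  have e2 : ∀ x, η x • V.indicator D x w = U.indicator (fun x => η x • D x w) x := by
    intro x
    by_cases hx : x ∈ V
    · rw [indicator_of_mem hx, indicator_of_mem (hVU hx)]
    · have h0 : η x = 0 := image_eq_zero_of_notMem_tsupport fun h' => hx (hηV h')
      simp [h0, indicator]
  simp_rw [e1, e2]
  rw [integral_indicator hU.measurableSet, integral_indicator hU.measurableSet, h]

/-- The derivative of the convolution falls on the kernel. The reflected kernel `t ↦ ρ(x - t)` is a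
test function supported in `V`, so the weak derivative identity moves the derivative onto `u`. -/
theorem HasWeakFDeriv.fderiv_convolution {U V : Set ℂ} {u : ℂ → ℂ} {D : ℂ → ℂ →L[ℝ] ℂ}
    (hu : HasWeakFDeriv U u D) (hU : IsOpen U) (hVU : V ⊆ U)
    (hi : LocallyIntegrable (V.indicator u)) (hDi : LocallyIntegrable (V.indicator D))
    (ρ : ContDiffBump (0 : ℂ)) {x : ℂ} (hx : closedBall x ρ.rOut ⊆ V) :
    fderiv ℝ (ρ.normed volume ⋆[ContinuousLinearMap.lsmul ℝ ℝ, volume] V.indicator u) x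
      = (ρ.normed volume ⋆[ContinuousLinearMap.lsmul ℝ ℝ, volume] V.indicator D) x := by
  have hρs : ContDiff ℝ ∞ (ρ.normed volume) := ρ.contDiff_normed
  have hρc := ρ.hasCompactSupport_normed (μ := volume)
  have hex : ConvolutionExistsAt (ρ.normed volume) (V.indicator D) x
      (ContinuousLinearMap.lsmul ℝ ℝ) volume :=
    hρc.convolutionExists_left _ ρ.continuous_normed hDi x
  have hex' : ConvolutionExistsAt (fderiv ℝ (ρ.normed volume)) (V.indicator u) x
      ((ContinuousLinearMap.lsmul ℝ ℝ).precompL ℂ) volume :=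
    (hρc.fderiv ℝ).convolutionExists_left _ (hρs.continuous_fderiv (by simp)) hi x
  ext1 w
  rw [(hρc.hasFDerivAt_convolution_left (ContinuousLinearMap.lsmul ℝ ℝ)
    (hρs.of_le (by exact_mod_cast le_top)) hi x).fderiv, convolution_eq_swap, convolution_eq_swap,
    ContinuousLinearMap.integral_apply, ContinuousLinearMap.integral_apply]
  · set η : ℂ → ℝ := fun t => ρ.normed volume (x - t) with hη
    have hηs : ContDiff ℝ ∞ η := hρs.comp (contDiff_const.sub contDiff_id)
    have hηV : tsupport η ⊆ closedBall x ρ.rOut := by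
      refine closure_minimal (fun t ht => ?_) isClosed_closedBall
      have : x - t ∈ Function.support (ρ.normed volume) := ht
      rw [ρ.support_normed_eq, mem_ball_zero_iff] at this
      rw [mem_closedBall, dist_comm, dist_eq_norm]
      exact this.le
    have hηc : HasCompactSupport η :=
      (isCompact_closedBall x ρ.rOut).of_isClosed_subset (isClosed_tsupport _) hηV
    have hder : ∀ t, fderiv ℝ η t w = - fderiv ℝ (ρ.normed volume) (x - t) w := by
      intro t
      have h1 : HasFDerivAt (fun t : ℂ => x - t) (-ContinuousLinearMap.id ℝ ℂ) t :=
        (hasFDerivAt_id t).const_sub x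
      have h2 := ((hρs.differentiable (by simp)) (x - t)).hasFDerivAt.comp t h1
      rw [show fderiv ℝ η t = _ from h2.fderiv]
      simp
    have := hu.integral_smul_indicator hU hVU hηs hηc (hηV.trans hx) w
    simp_rw [hder, neg_smul, integral_neg, neg_inj] at this
    exact this
  · exact hex.integrable_swap
  · exact hex'.integrable_swap

theorem memLp_indicator_of_restrict {E : Type*} [NormedAddCommGroup E] {p : ℝ≥0∞} {V : Set ℂ}
    (hV : MeasurableSet V) {g : ℂ → E} (hg : MemLp g p (volume.restrict V)) :
    MemLp (V.indicator g) p volume :=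
  (memLp_indicator_iff_restrict hV).2 hg

/-- Local approximation of a continuous `W^1_2` map by smooth maps. -/
theorem HasWeakFDeriv.exists_contDiff_approx {U : Set ℂ} {u : ℂ → ℂ} {D : ℂ → ℂ →L[ℝ] ℂ}
    (hu : HasWeakFDeriv U u D) (hU : IsOpen U) (hc : ContinuousOn u U)
    (hD : ∀ C : Set ℂ, IsCompact C → C ⊆ U → MemLp D 2 (volume.restrict C))
    {C : Set ℂ} (hC : IsCompact C) (hCU : C ⊆ U) {ε : ℝ} (hε : 0 < ε) :
    ∃ v : ℂ → ℂ, ContDiff ℝ ∞ v ∧ (∀ x ∈ C, dist (v x) (u x) ≤ ε) ∧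
      eLpNorm (fun x => fderiv ℝ v x - D x) 2 (volume.restrict C) ≤ ENNReal.ofReal ε := by
  obtain ⟨δ, hδ, hδU⟩ := hC.exists_cthickening_subset_open hU hCU
  set V := cthickening δ C with hV
  have hVc : IsCompact V := hC.cthickening
  have hVm : MeasurableSet V := hVc.measurableSet
  have hi : Integrable (V.indicator u) :=
    ((hc.mono hδU).integrableOn_compact hVc).integrable_indicator hVm
  have hD2 : MemLp (V.indicator D) 2 volume := memLp_indicator_of_restrict hVm (hD V hVc hδU)
  have hDi : LocallyIntegrable (V.indicator D) := hD2.locallyIntegrable (by norm_num)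
  obtain ⟨δ₁, hδ₁, hu₁⟩ := Metric.uniformContinuousOn_iff_le.1
    (hVc.uniformContinuousOn_of_continuous (hc.mono hδU)) ε hε
  have hev := (tendsto_eLpNorm_translate_sub hD2).eventually_le_const
    (ENNReal.ofReal_pos.2 hε)
  obtain ⟨δ₂, hδ₂, hu₂⟩ := Metric.eventually_nhds_iff_ball.1 hev
  -- The radius `δ` keeps the mollification inside `V`, `δ₁` controls the uniform modulus of
  -- continuity of `u`, and `δ₂` the `L²` modulus of `D`.
  set r := min δ (min δ₁ δ₂) with hr
  have hr0 : 0 < r := by positivity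
  obtain ⟨ρ, hρ⟩ : ∃ ρ : ContDiffBump (0 : ℂ), ρ.rOut = r :=
    ⟨⟨r / 2, r, by positivity, by linarith⟩, rfl⟩
  have hball : ∀ x ∈ C, closedBall x ρ.rOut ⊆ V := fun x hx => hρ ▸
    (closedBall_subset_closedBall (min_le_left _ _)).trans (closedBall_subset_cthickening hx δ)
  let v : ℂ → ℂ := ρ.normed volume ⋆[ContinuousLinearMap.lsmul ℝ ℝ, volume] V.indicator u
  refine ⟨v, ?_, ?_, ?_⟩
  · exact ρ.hasCompactSupport_normed.contDiff_convolution_left (n := ⊤) _ ρ.contDiff_normed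
      hi.locallyIntegrable
  · intro x hx
    have hxV : x ∈ V := hball x hx (mem_closedBall_self ρ.rOut_pos.le)
    have := ρ.dist_normed_convolution_le (μ := volume) (g := V.indicator u) (x₀ := x) (ε := ε)
      hi.aestronglyMeasurable (fun y hy => by
        have hyV : y ∈ V := hball x hx (ball_subset_closedBall hy)
        rw [indicator_of_mem hyV, indicator_of_mem hxV]
        refine hu₁ y hyV x hxV ?_
        exact (mem_ball.1 hy).le.trans (hρ.le.trans <| (min_le_right _ _).trans (min_le_left _ _)))
    rwa [indicator_of_mem hxV] at this
  · have key := eLpNorm_normed_convolution_sub_le hD2 ρ (ε := ENNReal.ofReal ε) fun t ht =>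
      hu₂ t (ball_subset_ball (hρ.le.trans <| (min_le_right _ _).trans (min_le_right _ _)) ht)
    refine le_trans (le_of_eq_of_le ?_ (eLpNorm_mono_measure _
      (Measure.restrict_le_self (s := C)))) key
    refine eLpNorm_congr_ae ?_
    filter_upwards [ae_restrict_mem hC.measurableSet] with x hx
    rw [hu.fderiv_convolution hU hδU hi.locallyIntegrable hDi ρ (hball x hx),
      indicator_of_mem (hball x hx (mem_closedBall_self ρ.rOut_pos.le))]

/-! ### The Jacobian as a null Lagrangian -/

theorem integrableOn_smul_of_locallyIntegrableOn {E : Type*} [NormedAddCommGroup E]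
    [NormedSpace ℝ E] {U : Set ℂ} (hU : IsOpen U) {g : ℂ → E} (hg : LocallyIntegrableOn g U)
    {η : ℂ → ℝ} (hη : Continuous η) (hηc : HasCompactSupport η) (hηU : tsupport η ⊆ U) :
    IntegrableOn (fun x => η x • g x) U := by
  have h1 : IntegrableOn (fun x => η x • g x) (tsupport η) :=
    (hg.integrableOn_compact_subset hηU hηc).continuousOn_smul hη.continuousOn hηc
  refine h1.of_forall_sdiff_eq_zero hU.measurableSet fun x hx => ?_
  rw [image_eq_zero_of_notMem_tsupport hx.2, zero_smul]

theorem exists_contDiff_one_nhds {K U : Set ℂ} (hK : IsCompact K) (hU : IsOpen U) (hKU : K ⊆ U) :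
    ∃ χ : ℂ → ℝ, ContDiff ℝ ∞ χ ∧ HasCompactSupport χ ∧ tsupport χ ⊆ U ∧
      (∀ x ∈ K, χ =ᶠ[𝓝 x] 1) ∧ ∀ x, χ x ∈ Icc (0 : ℝ) 1 := by
  obtain ⟨V, hV, hKV, hVU⟩ := exists_compact_between hK hU hKU
  obtain ⟨f, hf1, hf0, hf⟩ := exists_contMDiffMap_one_nhds_of_subset_interior
    (n := (⊤ : ℕ∞)) (modelWithCornersSelf ℝ ℂ) hK.isClosed hKV
  have hs : tsupport f ⊆ V := closure_minimal
    (fun x hx => by_contra fun h => hx (hf0 x h)) hV.isClosed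
  refine ⟨f, f.contMDiff.contDiff, hV.of_isClosed_subset (isClosed_tsupport _) hs, hs.trans hVU,
    fun x hx => ?_, hf⟩
  exact (Filter.eventually_iff_exists_mem.1 hf1).elim fun s hs' =>
    mem_of_superset (mem_nhdsSet_iff_forall.1 hs'.1 x hx) fun y hy => hs'.2 y hy

/-- The field `adj (D x) v` is the differential rotated by a quarter turn. Its weak divergence
vanishes because the mixed second derivatives of the test function agree. -/
theorem HasWeakFDeriv.integral_fderiv_adj {U : Set ℂ} (hU : IsOpen U) {u : ℂ → ℂ}
    {D : ℂ → ℂ →L[ℝ] ℂ} (hu : HasWeakFDeriv U u D) {h : ℂ → ℝ} (hh : ContDiff ℝ ∞ h)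
    (hhc : HasCompactSupport h) (hhU : tsupport h ⊆ U) (v : ℂ) :
    ∫ x in U, fderiv ℝ h x (adj (D x) v) = 0 := by
  have hd : ContDiff ℝ ∞ (fderiv ℝ h) := hh.fderiv_right (by simp)
  have hη : ∀ w, ContDiff ℝ ∞ (fun x => fderiv ℝ h x w) := fun w => hd.clm_apply contDiff_const
  have hs : ∀ w, tsupport (fun x => fderiv ℝ h x w) ⊆ tsupport h := fun w =>
    tsupport_fderiv_apply_subset ℝ w
  have hηc : ∀ w, HasCompactSupport (fun x => fderiv ℝ h x w) := fun w => hhc.fderiv_apply ℝ w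
  have hint : ∀ w w', IntegrableOn (fun x => fderiv ℝ h x w • D x w') U := fun w w' =>
    integrableOn_smul_of_locallyIntegrableOn hU
      (fun x hx => by
        obtain ⟨s, hs, hi⟩ := hu.locallyIntegrableOn_deriv x hx
        exact ⟨s, hs, hi.apply_continuousLinearMap w'⟩)
      (hη w).continuous (hηc w) ((hs w).trans hhU)
  -- This functional, `z ↦ v.re * z.im - v.im * z.re`, extracts the pairing with `v` from the
  -- complex-valued expression `∂₁h • D i - ∂ᵢh • D 1`, whose integral is zero.
  let ℓ : ℂ →L[ℝ] ℝ := v.re • Complex.imCLM - v.im • Complex.reCLM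
  have hsymm : ∀ x, fderiv ℝ (fun x => fderiv ℝ h x 1) x Complex.I
      = fderiv ℝ (fun x => fderiv ℝ h x Complex.I) x 1 := by
    intro x
    have hdx : DifferentiableAt ℝ (fderiv ℝ h) x := (hd.differentiable (by simp)) x
    have h2 : IsSymmSndFDerivAt ℝ h x := hh.contDiffAt.isSymmSndFDerivAt (by
      simp only [minSmoothness_of_isRCLikeNormedField]; exact WithTop.coe_le_coe.2 (le_top : (2 : ℕ∞) ≤ ⊤))
    have e : ∀ a b : ℂ, fderiv ℝ (fun x => fderiv ℝ h x a) x b = fderiv ℝ (fderiv ℝ h) x b a := by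
      intro a b
      rw [fderiv_clm_apply hdx (differentiableAt_const a)]
      simp
    rw [e, e]
    exact h2 _ _
  have e : ∀ x, fderiv ℝ h x (adj (D x) v)
      = ℓ (fderiv ℝ h x 1 • D x Complex.I - fderiv ℝ h x Complex.I • D x 1) := by
    intro x
    have : ∀ z : ℂ, fderiv ℝ h x z = z.re * fderiv ℝ h x 1 + z.im * fderiv ℝ h x Complex.I := by
      intro z
      conv_lhs => rw [show z = z.re • (1 : ℂ) + z.im • Complex.I by
        apply Complex.ext <;> simp]
      rw [map_add, map_smul, map_smul]; simp
    rw [this, adj_apply]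
    simp [ℓ]; ring
  simp_rw [e]
  have hcomm := ℓ.integral_comp_comm (μ := volume.restrict U)
    (φ := fun x => fderiv ℝ h x 1 • D x Complex.I - fderiv ℝ h x Complex.I • D x 1)
    ((hint _ _).sub (hint _ _))
  rw [hcomm, integral_sub (hint _ _) (hint _ _)]
  have h1 := hu.integral_eq _ (hη 1) (hηc 1) ((hs 1).trans hhU) Complex.I
  have h2 := hu.integral_eq _ (hη Complex.I) (hηc Complex.I) ((hs Complex.I).trans hhU) 1
  simp_rw [hsymm] at h1
  rw [h1, neg_inj] at h2
  rw [h2, sub_self, map_zero]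

/-- Lets the integration by parts for Jacobians be applied to the smooth approximants themselves. -/
theorem hasWeakFDeriv_of_contDiff {u : ℂ → ℂ} (hu : ContDiff ℝ ∞ u) :
    HasWeakFDeriv univ u (fderiv ℝ u) := by
  have hd : Continuous (fderiv ℝ u) := hu.continuous_fderiv (by simp)
  refine ⟨hu.continuous.locallyIntegrable.locallyIntegrableOn _,
    hd.locallyIntegrable.locallyIntegrableOn _, fun η hη hηc _ v => ?_⟩
  have hdη : Continuous (fderiv ℝ η) := hη.continuous_fderiv (by simp)
  have hc := hu.continuous
  have hcη := hη.continuous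
  simp only [Measure.restrict_univ]
  rw [integral_smul_fderiv_eq_neg_fderiv_smul_of_integrable, neg_neg]
  · exact Continuous.integrable_of_hasCompactSupport (by fun_prop) ((hηc.fderiv_apply ℝ v).smul_right)
  · exact Continuous.integrable_of_hasCompactSupport (by fun_prop) (hηc.smul_right)
  · exact Continuous.integrable_of_hasCompactSupport (by fun_prop) (hηc.smul_right)
  · exact fun x _ => hη.differentiable (by simp) x
  · exact fun x _ => hu.differentiable (by simp) x

theorem lintegral_enorm_mul_enorm_le {α E F : Type*} [MeasurableSpace α] [NormedAddCommGroup E]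
    [NormedAddCommGroup F] {μ : Measure α} {f : α → E} {g : α → F} (hf : AEStronglyMeasurable f μ)
    (hg : AEStronglyMeasurable g μ) :
    ∫⁻ x, ‖f x‖ₑ * ‖g x‖ₑ ∂μ ≤ eLpNorm f 2 μ * eLpNorm g 2 μ := by
  have := ENNReal.lintegral_mul_le_Lp_mul_Lq μ Real.HolderConjugate.two_two hf.enorm hg.enorm
  rw [eLpNorm_eq_lintegral_rpow_enorm_toReal (by simp) (by simp),
    eLpNorm_eq_lintegral_rpow_enorm_toReal (by simp) (by simp)]
  simpa using this

theorem MemLp.integrable_det {μ : Measure ℂ} {D : ℂ → ℂ →L[ℝ] ℂ} (hD : MemLp D 2 μ) :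
    Integrable (fun x => (D x).det) μ := by
  refine (hD.integrable_norm_pow (p := 2) (by simp)).mono'
    (continuous_det.comp_aestronglyMeasurable hD.1) (Eventually.of_forall fun x => ?_)
  exact abs_det_le _

theorem exists_bound_of_hasCompactSupport {E F : Type*} [TopologicalSpace E]
    [NormedAddCommGroup F] {f : E → F} (hf : Continuous f) (hc : HasCompactSupport f) :
    ∃ M, 0 ≤ M ∧ ∀ x, ‖f x‖ ≤ M := by
  obtain ⟨M, hM⟩ := hf.bounded_above_of_compact_support hc
  exact ⟨max M 0, le_max_right _ _, fun x => (hM x).trans (le_max_left _ _)⟩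

/-- The sequence version of the local approximation of `W^1_2` maps by smooth maps. -/
theorem HasWeakFDeriv.exists_seq_approx {U : Set ℂ} {u : ℂ → ℂ} {D : ℂ → ℂ →L[ℝ] ℂ}
    (hu : HasWeakFDeriv U u D) (hU : IsOpen U) (hc : ContinuousOn u U)
    (hD : ∀ C : Set ℂ, IsCompact C → C ⊆ U → MemLp D 2 (volume.restrict C))
    {C : Set ℂ} (hC : IsCompact C) (hCU : C ⊆ U) :
    ∃ v : ℕ → ℂ → ℂ, (∀ n, ContDiff ℝ ∞ (v n)) ∧
      (∀ ε > 0, ∀ᶠ n in atTop, ∀ x ∈ C, dist (v n x) (u x) ≤ ε) ∧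
      Tendsto (fun n => eLpNorm (fun x => fderiv ℝ (v n) x - D x) 2 (volume.restrict C))
        atTop (𝓝 0) := by
  choose v hv h1 h2 using fun n : ℕ =>
    hu.exists_contDiff_approx hU hc hD hC hCU (Nat.one_div_pos_of_nat (α := ℝ) (n := n))
  refine ⟨v, hv, fun ε hε => ?_, ?_⟩
  · filter_upwards [(tendsto_one_div_add_atTop_nhds_zero_nat (𝕜 := ℝ)).eventually_le_const hε]
      with n hn x hx using (h1 n x hx).trans hn
  · refine tendsto_of_tendsto_of_tendsto_of_le_of_le tendsto_const_nhds ?_ (fun _ => zero_le) h2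
    simpa using ENNReal.tendsto_ofReal (tendsto_one_div_add_atTop_nhds_zero_nat (𝕜 := ℝ))

/-- Integration by parts for the Jacobian of a continuous `W^1_2` map, with a compactly supported
smooth weight. -/
theorem HasWeakFDeriv.integral_comp_mul_fderiv_adj_add {U : Set ℂ} (hU : IsOpen U) {u : ℂ → ℂ}
    {D : ℂ → ℂ →L[ℝ] ℂ} (hu : HasWeakFDeriv U u D) (hc : ContinuousOn u U)
    (hD : ∀ C : Set ℂ, IsCompact C → C ⊆ U → MemLp D 2 (volume.restrict C))
    {F q : ℂ → ℝ} (hF : ContDiff ℝ ∞ F) (hFc : HasCompactSupport F) (hq : ContDiff ℝ ∞ q)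
    (hqc : HasCompactSupport q) (hqU : tsupport q ⊆ U) (v : ℂ) :
    ∫ x in tsupport q, (F (u x) * fderiv ℝ q x (adj (D x) v)
      + q x * ((D x).det * fderiv ℝ F (u x) v)) = 0 := by
  set C := tsupport q with hCdef
  have hCc : IsCompact C := hqc
  set μ := volume.restrict C with hμ
  have hD2 : MemLp D 2 μ := hD C hCc hqU
  have hDm := hD2.1
  have : IsFiniteMeasure μ := isFiniteMeasure_restrict.2 hCc.measure_lt_top.ne
  have hD1 : Integrable (fun x => ‖D x‖) μ := (hD2.integrable one_le_two).norm
  have hJ : Integrable (fun x => |(D x).det|) μ := (MemLp.integrable_det hD2).abs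
  obtain ⟨w, hw, hwu, hwD⟩ := hu.exists_seq_approx hU hc hD hCc hqU
  have hFcont := hF.continuous
  have hF' : Continuous (fderiv ℝ F) := hF.continuous_fderiv (by simp)
  have hqcont := hq.continuous
  have hq' : Continuous (fderiv ℝ q) := hq.continuous_fderiv (by simp)
  have hwc : ∀ n, Continuous (w n) := fun n => (hw n).continuous
  have hw' : ∀ n, Continuous (fderiv ℝ (w n)) := fun n => (hw n).continuous_fderiv (by simp)
  have hadj := continuous_adj
  have hdet := continuous_det
  obtain ⟨M₁, hM₁, hFb⟩ := exists_bound_of_hasCompactSupport hFcont hFc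
  obtain ⟨M₂, hM₂, hF'b⟩ := exists_bound_of_hasCompactSupport hF' (hFc.fderiv ℝ)
  obtain ⟨N₁, hN₁, hqb⟩ := exists_bound_of_hasCompactSupport hqcont hqc
  obtain ⟨N₂, hN₂, hq'b⟩ := exists_bound_of_hasCompactSupport hq' (hqc.fderiv ℝ)
  have hpair : AEStronglyMeasurable (fun x => (x, D x)) μ :=
    aestronglyMeasurable_id.prodMk hDm
  have hmeas : ∀ G : ℂ × (ℂ →L[ℝ] ℂ) → ℝ, Continuous G →
      AEStronglyMeasurable (fun x => G (x, D x)) μ := fun G hG => hG.comp_aestronglyMeasurable hpair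
  -- Only the argument of `F` is smoothed; `D` is kept, so that `F(w n) · q` can be tested against
  -- the divergence-free field. The chain rule then produces `fderiv ℝ (w n) x` where `D x` is
  -- wanted. Since `D x (adj (D x) v) = det (D x) • v`, the identity holds for `A` up to the error
  -- `B`.
  let A : ℕ → ℂ → ℝ := fun n x => F (w n x) * fderiv ℝ q x (adj (D x) v)
      + q x * ((D x).det * fderiv ℝ F (w n x) v)
  let B : ℕ → ℂ → ℝ := fun n x => q x * fderiv ℝ F (w n x) ((fderiv ℝ (w n) x - D x) (adj (D x) v))
  have hAm : ∀ n, AEStronglyMeasurable (A n) μ := fun n =>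
    hmeas (fun p => F (w n p.1) * fderiv ℝ q p.1 (adj p.2 v)
      + q p.1 * (p.2.det * fderiv ℝ F (w n p.1) v))
      (((hFcont.comp ((hwc n).comp continuous_fst)).mul ((hq'.comp continuous_fst).clm_apply
        ((hadj.comp continuous_snd).clm_apply continuous_const))).add
      ((hqcont.comp continuous_fst).mul ((hdet.comp continuous_snd).mul
        ((hF'.comp ((hwc n).comp continuous_fst)).clm_apply continuous_const))))
  have hBm : ∀ n, AEStronglyMeasurable (B n) μ := fun n =>
    hmeas (fun p => q p.1 * fderiv ℝ F (w n p.1) ((fderiv ℝ (w n) p.1 - p.2) (adj p.2 v)))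
      ((hqcont.comp continuous_fst).mul ((hF'.comp ((hwc n).comp continuous_fst)).clm_apply
        ((((hw' n).comp continuous_fst).sub continuous_snd).clm_apply
        ((hadj.comp continuous_snd).clm_apply continuous_const))))
  let bound : ℂ → ℝ := fun x => M₁ * (N₂ * (3 * ‖D x‖ * ‖v‖)) + N₁ * (|(D x).det| * (M₂ * ‖v‖))
  have hbi : Integrable bound μ := by
    refine Integrable.add ?_ ?_
    · exact (((hD1.const_mul 3).mul_const ‖v‖).const_mul N₂).const_mul M₁
    · exact (hJ.mul_const _).const_mul N₁
  have hadjv : ∀ x, ‖adj (D x) v‖ ≤ 3 * ‖D x‖ * ‖v‖ := fun x =>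
    (adj (D x)).le_of_opNorm_le (norm_adj_le _) v
  have hAb : ∀ n x, ‖A n x‖ ≤ bound x := by
    intro n x
    refine (norm_add_le _ _).trans (add_le_add ?_ ?_)
    · rw [norm_mul]
      refine mul_le_mul (hFb _) ?_ (norm_nonneg _) hM₁
      exact (fderiv ℝ q x).le_of_opNorm_le_of_le (hq'b x) (hadjv x)
    · rw [norm_mul, norm_mul]
      refine mul_le_mul (hqb _) ?_ (by positivity) hN₁
      exact mul_le_mul_of_nonneg_left ((fderiv ℝ F _).le_of_opNorm_le (hF'b _) v) (norm_nonneg _)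
  have hAi : ∀ n, Integrable (A n) μ := fun n => hbi.mono' (hAm n) (Eventually.of_forall (hAb n))
  have hwt : ∀ x ∈ C, Tendsto (fun n => w n x) atTop (𝓝 (u x)) := by
    intro x hx
    rw [Metric.tendsto_nhds]
    intro ε hε
    filter_upwards [hwu (ε / 2) (by positivity)] with n hn
    exact (hn x hx).trans_lt (by linarith)
  have hAlim : Tendsto (fun n => ∫ x, A n x ∂μ) atTop
      (𝓝 (∫ x, (F (u x) * fderiv ℝ q x (adj (D x) v)
      + q x * ((D x).det * fderiv ℝ F (u x) v)) ∂μ)) := by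
    refine tendsto_integral_of_dominated_convergence bound hAm hbi
      (fun n => Eventually.of_forall (hAb n)) ?_
    filter_upwards [ae_restrict_mem hCc.measurableSet] with x hx
    have t1 := (hFcont.tendsto (u x)).comp (hwt x hx)
    have t2 := (hF'.tendsto (u x)).comp (hwt x hx)
    have t3 : Tendsto (fun n => fderiv ℝ F (w n x) v) atTop (𝓝 (fderiv ℝ F (u x) v)) :=
      ((ContinuousLinearMap.apply ℝ ℝ v).continuous.tendsto _).comp t2
    exact (t1.mul_const _).add ((t3.const_mul _).const_mul _)
  set c₀ : ℝ := N₁ * (M₂ * (3 * ‖v‖)) with hc₀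
  have hBb : ∀ n x, ‖B n x‖ ≤ c₀ * (‖fderiv ℝ (w n) x - D x‖ * ‖D x‖) := by
    intro n x
    have h1 : ‖(fderiv ℝ (w n) x - D x) (adj (D x) v)‖
        ≤ ‖fderiv ℝ (w n) x - D x‖ * (3 * ‖D x‖ * ‖v‖) :=
      (fderiv ℝ (w n) x - D x).le_of_opNorm_le_of_le le_rfl (hadjv x)
    have h2 := (fderiv ℝ F (w n x)).le_of_opNorm_le_of_le (hF'b _) h1
    have h3 : ‖B n x‖ ≤ N₁ * (M₂ * (‖fderiv ℝ (w n) x - D x‖ * (3 * ‖D x‖ * ‖v‖))) := by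
      simp only [B]
      rw [norm_mul]
      exact mul_le_mul (hqb _) h2 (norm_nonneg _) hN₁
    refine h3.trans_eq ?_
    rw [hc₀]; ring
  have hBl : ∀ n, ∫⁻ x, ‖B n x‖ₑ ∂μ ≤ ENNReal.ofReal c₀ *
      (eLpNorm (fun x => fderiv ℝ (w n) x - D x) 2 μ * eLpNorm D 2 μ) := by
    intro n
    have hm : AEStronglyMeasurable (fun x => fderiv ℝ (w n) x - D x) μ :=
      (hw' n).aestronglyMeasurable.sub hDm
    refine le_trans ?_ (mul_le_mul_right (lintegral_enorm_mul_enorm_le hm hDm) _)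
    rw [← lintegral_const_mul' _ _ ENNReal.ofReal_ne_top]
    refine lintegral_mono fun x => ?_
    rw [← ofReal_norm (B n x), ← ofReal_norm (D x), ← ofReal_norm (fderiv ℝ (w n) x - D x),
      ← ENNReal.ofReal_mul (norm_nonneg _), ← ENNReal.ofReal_mul (by positivity)]
    exact ENNReal.ofReal_le_ofReal (hBb n x)
  have hlim0 : Tendsto (fun n => ENNReal.ofReal c₀ *
      (eLpNorm (fun x => fderiv ℝ (w n) x - D x) 2 μ * eLpNorm D 2 μ)) atTop (𝓝 0) := by
    have := ENNReal.Tendsto.const_mul (a := ENNReal.ofReal c₀)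
      (ENNReal.Tendsto.mul_const (b := eLpNorm D 2 μ) hwD (Or.inr hD2.2.ne))
      (Or.inr ENNReal.ofReal_ne_top)
    simpa using this
  have hBlim : Tendsto (fun n => ∫ x, B n x ∂μ) atTop (𝓝 0) := by
    rw [tendsto_iff_edist_tendsto_0]
    refine tendsto_of_tendsto_of_tendsto_of_le_of_le tendsto_const_nhds hlim0 (fun _ => zero_le)
      fun n => ?_
    simp only [edist_zero_right]
    exact (enorm_integral_le_lintegral_enorm _).trans (hBl n)
  -- Integrability of `B n` is read off from its bound, which is below `1` for large `n`.
  have hsum : ∀ᶠ n in atTop, ∫ x, A n x ∂μ + ∫ x, B n x ∂μ = 0 := by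
    filter_upwards [hlim0.eventually_lt_const zero_lt_one] with n hn
    have hBi : Integrable (B n) μ := ⟨hBm n, (hBl n).trans_lt (hn.trans (by simp))⟩
    have hs : ContDiff ℝ ∞ (fun x => F (w n x) * q x) := (hF.comp (hw n)).mul hq
    have hss : tsupport (fun x => F (w n x) * q x) ⊆ C := tsupport_mul_subset_right
    have h0 := hu.integral_fderiv_adj hU hs (hCc.of_isClosed_subset (isClosed_tsupport _) hss)
      (hss.trans hqU) v
    rw [setIntegral_eq_of_subset_of_forall_sdiff_eq_zero hU.measurableSet hqU] at h0
    · rw [← integral_add (hAi n) hBi, ← h0]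
      refine integral_congr_ae (Eventually.of_forall fun x => ?_)
      have hFx : HasFDerivAt (fun x => F (w n x)) ((fderiv ℝ F (w n x)).comp (fderiv ℝ (w n) x)) x :=
        (hF.differentiable (by simp) (w n x)).hasFDerivAt.comp x
          ((hw n).differentiable (by simp) x).hasFDerivAt
      have hqx := (hq.differentiable (by simp) x).hasFDerivAt
      simp only [A, B]
      rw [show fderiv ℝ (fun x => F (w n x) * q x) x = _ from (hFx.mul hqx).fderiv, sub_apply, apply_adj, map_sub, map_smul]
      simp
      ring
    · intro x hx
      have : fderiv ℝ (fun x => F (w n x) * q x) x = 0 :=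
        image_eq_zero_of_notMem_tsupport fun h => hx.2 (hss (tsupport_fderiv_subset ℝ h))
      simp [this]
  have := hAlim.add hBlim
  rw [add_zero] at this
  exact tendsto_nhds_unique this (tendsto_const_nhds.congr' (hsum.mono fun n hn => hn.symm))

/-- A homeomorphism is proper: `F ∘ φ` lives on the compact set `φ⁻¹(supp F)`, so local
integrability on the source suffices for all integrals against it. -/
theorem isCompact_symm_image_tsupport (φ : OpenPartialHomeomorph ℂ ℂ) {E : Type*} [Zero E]
    {F : ℂ → E} (hFc : HasCompactSupport F) (hFt : tsupport F ⊆ φ.target) :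
    IsCompact (φ.symm '' tsupport F) :=
  IsCompact.image_of_continuousOn hFc (φ.continuousOn_symm.mono hFt)

theorem symm_image_subset_source (φ : OpenPartialHomeomorph ℂ ℂ) {S : Set ℂ}
    (hS : S ⊆ φ.target) : φ.symm '' S ⊆ φ.source := by
  rintro _ ⟨y, hy, rfl⟩
  exact φ.map_target (hS hy)

theorem comp_eq_zero_of_notMem {E : Type*} [Zero E] (φ : OpenPartialHomeomorph ℂ ℂ) {F : ℂ → E}
    {x : ℂ} (hx : x ∈ φ.source \ φ.symm '' tsupport F) : F (φ x) = 0 :=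
  image_eq_zero_of_notMem_tsupport fun h => hx.2 ⟨φ x, h, φ.left_inv hx.1⟩

theorem integrableOn_comp_smul (φ : OpenPartialHomeomorph ℂ ℂ) {E : Type*} [NormedAddCommGroup E]
    [NormedSpace ℝ E] {F : ℂ → ℝ} (hF : Continuous F) (hFc : HasCompactSupport F)
    (hFt : tsupport F ⊆ φ.target) {g : ℂ → E} (hg : LocallyIntegrableOn g φ.source) :
    IntegrableOn (fun x => F (φ x) • g x) φ.source := by
  have hW := isCompact_symm_image_tsupport φ hFc hFt
  have hWs := symm_image_subset_source φ hFt
  have h1 : IntegrableOn (fun x => F (φ x) • g x) (φ.symm '' tsupport F) :=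
    (hg.integrableOn_compact_subset hWs hW).continuousOn_smul
      (hF.comp_continuousOn (φ.continuousOn.mono hWs)) hW
  refine h1.of_forall_sdiff_eq_zero φ.open_source.measurableSet fun x hx => ?_
  rw [comp_eq_zero_of_notMem φ hx, zero_smul]

theorem locallyIntegrableOn_det {U : Set ℂ} (hU : IsOpen U) {D : ℂ → ℂ →L[ℝ] ℂ}
    (hD : ∀ C : Set ℂ, IsCompact C → C ⊆ U → MemLp D 2 (volume.restrict C)) :
    LocallyIntegrableOn (fun x => (D x).det) U := by
  rw [locallyIntegrableOn_iff hU.isLocallyClosed]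
  exact fun C hCU hC => MemLp.integrable_det (hD C hC hCU)

/-- Integration by parts for the Jacobian of a `W^1_2` homeomorphism. -/
theorem integral_mul_det_mul_fderiv_comp (φ : OpenPartialHomeomorph ℂ ℂ) {D : ℂ → ℂ →L[ℝ] ℂ}
    (hu : HasWeakFDeriv φ.source φ D)
    (hD : ∀ C : Set ℂ, IsCompact C → C ⊆ φ.source → MemLp D 2 (volume.restrict C))
    {F p : ℂ → ℝ} (hF : ContDiff ℝ ∞ F) (hFc : HasCompactSupport F)
    (hFt : tsupport F ⊆ φ.target) (hp : ContDiff ℝ ∞ p) (v : ℂ) :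
    ∫ x in φ.source, p x * ((D x).det * fderiv ℝ F (φ x) v)
      = - ∫ x in φ.source, F (φ x) * fderiv ℝ p x (adj (D x) v) := by
  have hW := isCompact_symm_image_tsupport φ hFc hFt
  have hWs := symm_image_subset_source φ hFt
  -- The weight `p` need not have compact support, but `F ∘ φ` does. Multiplying `p` by a cutoff
  -- equal to `1` near `φ⁻¹(supp F)` changes neither integral.
  obtain ⟨χ, hχ, hχc, hχs, hχ1, -⟩ := exists_contDiff_one_nhds hW φ.open_source hWs
  set q : ℂ → ℝ := fun x => χ x * p x with hq
  have hqs : tsupport q ⊆ tsupport χ := tsupport_mul_subset_left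
  have key := hu.integral_comp_mul_fderiv_adj_add φ.open_source φ.continuousOn hD hF hFc
    (hχ.mul hp) (hχc.of_isClosed_subset (isClosed_tsupport _) hqs) (hqs.trans hχs) v
  have hF's : tsupport (fderiv ℝ F) ⊆ tsupport F := tsupport_fderiv_subset ℝ
  rw [← setIntegral_eq_of_subset_of_forall_sdiff_eq_zero φ.open_source.measurableSet
    (hqs.trans hχs)] at key
  · have hp' : Continuous (fderiv ℝ p) := hp.continuous_fderiv (by simp)
    have hi1 : IntegrableOn (fun x => F (φ x) * fderiv ℝ p x (adj (D x) v)) φ.source := by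
      refine integrableOn_comp_smul φ hF.continuous hFc hFt (g := fun x => fderiv ℝ p x (adj (D x) v))
        ?_
      rw [locallyIntegrableOn_iff φ.open_source.isLocallyClosed]
      intro C hCs hC
      have hC1 : IsFiniteMeasure (volume.restrict C) :=
        isFiniteMeasure_restrict.2 hC.measure_lt_top.ne
      have hDC := hD C hC hCs
      obtain ⟨M, hM⟩ := hC.exists_bound_of_continuousOn hp'.continuousOn
      refine ((hDC.integrable one_le_two).norm.const_mul (M * (3 * ‖v‖))).mono' ?_ ?_
      · exact Continuous.comp_aestronglyMeasurable
          (g := fun P : ℂ × (ℂ →L[ℝ] ℂ) => fderiv ℝ p P.1 (adj P.2 v))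
          ((hp'.comp continuous_fst).clm_apply
            ((continuous_adj.comp continuous_snd).clm_apply continuous_const))
          (aestronglyMeasurable_id.prodMk hDC.1)
      · filter_upwards [ae_restrict_mem hC.measurableSet] with x hx
        refine ((fderiv ℝ p x).le_of_opNorm_le_of_le (hM x hx)
          ((adj (D x)).le_of_opNorm_le (norm_adj_le _) v)).trans_eq (by ring)
    have hi2 : IntegrableOn (fun x => p x * ((D x).det * fderiv ℝ F (φ x) v)) φ.source := by
      have hF'v : Continuous (fun y => fderiv ℝ F y v) :=
        (hF.continuous_fderiv (by simp)).clm_apply continuous_const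
      have := integrableOn_comp_smul φ hF'v (hFc.fderiv_apply ℝ v)
        ((tsupport_fderiv_apply_subset ℝ v).trans hFt)
        ((locallyIntegrableOn_det φ.open_source hD).continuousOn_smul
          φ.open_source.isLocallyClosed hp.continuous.continuousOn)
      refine this.congr (Eventually.of_forall fun x => ?_)
      simp only [smul_eq_mul]; ring
    rw [eq_neg_iff_add_eq_zero, add_comm, ← integral_add hi1 hi2, ← key]
    refine setIntegral_congr_fun φ.open_source.measurableSet fun x hx => ?_
    by_cases hxW : x ∈ φ.symm '' tsupport F
    · have h1 : q =ᶠ[𝓝 x] p := by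
        filter_upwards [hχ1 x hxW] with y hy
        simp [hq, hy]
      rw [show (fun x => χ x * p x) = q from rfl, h1.fderiv_eq, show χ x * p x = p x from h1.eq_of_nhds]
    · have h2 : fderiv ℝ F (φ x) = 0 :=
        image_eq_zero_of_notMem_tsupport fun h => hxW ⟨φ x, hF's h, φ.left_inv hx⟩
      rw [comp_eq_zero_of_notMem φ ⟨hx, hxW⟩, h2]; simp
  · intro x hx
    have h1 : fderiv ℝ q x = 0 :=
      image_eq_zero_of_notMem_tsupport fun h => hx.2 (tsupport_fderiv_subset ℝ h)
    have h2 : q x = 0 := image_eq_zero_of_notMem_tsupport hx.2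
    have h3 : χ x * p x = 0 := h2
    rw [show (fun x => χ x * p x) = q from rfl, h1, h3]; simp

/-! ### Distributions with vanishing gradient -/

/-- Both measures have densities with respect to their sum, and the fundamental lemma of the
calculus of variations applies to the difference of these densities. -/
theorem restrict_eq_of_integral_contDiff_eq {m₁ m₂ : Measure ℂ} [IsFiniteMeasure m₁]
    [IsFiniteMeasure m₂] {U : Set ℂ} (hU : IsOpen U)
    (h : ∀ g : ℂ → ℝ, ContDiff ℝ ∞ g → HasCompactSupport g → tsupport g ⊆ U →
      ∫ x, g x ∂m₁ = ∫ x, g x ∂m₂) : m₁.restrict U = m₂.restrict U := by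
  set m := m₁ + m₂ with hm
  have h1 : m₁ ≪ m := Measure.absolutelyContinuous_of_le (Measure.le_add_right le_rfl)
  have h2 : m₂ ≪ m := Measure.absolutelyContinuous_of_le (Measure.le_add_left le_rfl)
  have hi1 : Integrable (fun x => (m₁.rnDeriv m x).toReal) m := Measure.integrable_toReal_rnDeriv
  have hi2 : Integrable (fun x => (m₂.rnDeriv m x).toReal) m := Measure.integrable_toReal_rnDeriv
  have h0 : ∀ᵐ x ∂m, x ∈ U → (m₁.rnDeriv m x).toReal - (m₂.rnDeriv m x).toReal = 0 := by
    refine hU.ae_eq_zero_of_integral_contDiff_smul_eq_zero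
      ((hi1.sub hi2).locallyIntegrable.locallyIntegrableOn U) fun g hg hgc hgU => ?_
    obtain ⟨M, -, hM⟩ := exists_bound_of_hasCompactSupport hg.continuous hgc
    have e1 := integral_rnDeriv_smul h1 (f := g)
    have e2 := integral_rnDeriv_smul h2 (f := g)
    have e3 : ∀ x, g x • ((m₁.rnDeriv m x).toReal - (m₂.rnDeriv m x).toReal)
        = (m₁.rnDeriv m x).toReal • g x - (m₂.rnDeriv m x).toReal • g x := fun x => by
      simp only [smul_eq_mul]; ring
    simp_rw [e3]
    rw [integral_sub, e1, e2, h g hg hgc hgU, sub_self]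
    · exact hi1.mul_bdd (c := M) hg.continuous.aestronglyMeasurable (Eventually.of_forall hM)
    · exact hi2.mul_bdd (c := M) hg.continuous.aestronglyMeasurable (Eventually.of_forall hM)
  ext s hs
  rw [Measure.restrict_apply hs, Measure.restrict_apply hs, ← Measure.setLIntegral_rnDeriv h1,
    ← Measure.setLIntegral_rnDeriv h2]
  refine setLIntegral_congr_fun_ae (hs.inter hU.measurableSet) ?_
  filter_upwards [h0, Measure.rnDeriv_lt_top m₁ m, Measure.rnDeriv_lt_top m₂ m] with x hx l1 l2 hxs
  exact (ENNReal.toReal_eq_toReal_iff' l1.ne l2.ne).1 (sub_eq_zero.1 (hx hxs.2))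

/-- Move the centre from `y` to `z` along the segment. The derivative in time is minus the
distribution's pairing with the directional derivative of a translated test function, which vanishes
as convexity keeps the support in `B`. -/
theorem integral_translate_eq_of_integral_fderiv_eq_zero {m : Measure ℂ} {u : ℂ → ℂ} {θ : ℂ → ℝ}
    (hu : AEMeasurable u m) (hθ : Integrable θ m) {B : Set ℂ} (hB : Convex ℝ B)
    (hz : ∀ G : ℂ → ℝ, ContDiff ℝ ∞ G → HasCompactSupport G → tsupport G ⊆ B → ∀ v : ℂ,
      ∫ x, fderiv ℝ G (u x) v * θ x ∂m = 0)
    {ρ : ℂ → ℝ} (hρ : ContDiff ℝ ∞ ρ) {δ : ℝ} (hρs : tsupport ρ ⊆ closedBall 0 δ)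
    {y z : ℂ} (hy : closedBall y δ ⊆ B) (hz' : closedBall z δ ⊆ B) :
    ∫ x, ρ (u x - y) * θ x ∂m = ∫ x, ρ (u x - z) * θ x ∂m := by
  have hρc : HasCompactSupport ρ :=
    (isCompact_closedBall 0 δ).of_isClosed_subset (isClosed_tsupport _) hρs
  have hρ' : Continuous (fderiv ℝ ρ) := hρ.continuous_fderiv (by simp)
  obtain ⟨M, hM0, hM⟩ := exists_bound_of_hasCompactSupport hρ' (hρc.fderiv ℝ)
  obtain ⟨N, hN0, hN⟩ := exists_bound_of_hasCompactSupport hρ.continuous hρc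
  let c : ℝ → ℂ := fun t => y + t • (z - y)
  have hc : ∀ t, HasDerivAt c (z - y) t := fun t => by
    have := ((hasDerivAt_id t).smul_const (z - y)).const_add y
    rwa [one_smul] at this
  let F : ℝ → ℂ → ℝ := fun t x => ρ (u x - c t) * θ x
  let F' : ℝ → ℂ → ℝ := fun t x => -fderiv ℝ ρ (u x - c t) (z - y) * θ x
  have hFm : ∀ t, AEStronglyMeasurable (F t) m := fun t =>
    ((hρ.continuous.measurable.comp_aemeasurable (hu.sub_const _)).aestronglyMeasurable).mul hθ.1
  have hF'm : ∀ t, AEStronglyMeasurable (F' t) m := fun t => by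
    have : Continuous fun w => -fderiv ℝ ρ w (z - y) := (hρ'.clm_apply continuous_const).neg
    exact ((this.measurable.comp_aemeasurable (hu.sub_const _)).aestronglyMeasurable).mul hθ.1
  have hder : ∀ t, HasDerivAt (fun t => ∫ x, F t x ∂m) (∫ x, F' t x ∂m) t := by
    intro t
    refine (hasDerivAt_integral_of_dominated_loc_of_deriv_le (F := F) (F' := F') (s := univ)
      (bound := fun x => M * ‖z - y‖ * ‖θ x‖) univ_mem (Eventually.of_forall hFm) ?_ (hF'm t) ?_
      (hθ.norm.const_mul _) ?_).2
    · exact (hθ.norm.const_mul N).mono' (hFm t) (Eventually.of_forall fun x => by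
        simp only [F, norm_mul]
        exact mul_le_mul_of_nonneg_right (hN _) (norm_nonneg _))
    · refine Eventually.of_forall fun x t _ => ?_
      simp only [F', norm_mul, norm_neg]
      exact mul_le_mul_of_nonneg_right ((fderiv ℝ ρ _).le_of_opNorm_le (hM _) _) (norm_nonneg _)
    · refine Eventually.of_forall fun x t _ => ?_
      have h1 : HasDerivAt (fun t => u x - c t) (-(z - y)) t := (hc t).const_sub (u x)
      have h2 := ((hρ.differentiable (by simp) (u x - c t)).hasFDerivAt.comp_hasDerivAt t h1)
      rw [map_neg] at h2
      exact h2.mul_const _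
  have hzero : ∀ t ∈ Icc (0 : ℝ) 1, ∫ x, F' t x ∂m = 0 := by
    intro t ht
    let G : ℂ → ℝ := fun w => ρ (w - c t)
    have hGs : tsupport G ⊆ closedBall (c t) δ := by
      refine closure_minimal (fun w hw => ?_) isClosed_closedBall
      have : w - c t ∈ closedBall (0 : ℂ) δ := hρs (subset_tsupport _ hw)
      rwa [mem_closedBall_zero_iff, ← dist_eq_norm] at this
    have hGB : closedBall (c t) δ ⊆ B := by
      intro w hw
      -- The offset `w - c t` is carried to both end balls, exhibiting `w` as a convex combination
      -- of their points.
      have e : w = (1 - t) • (w - c t + y) + t • (w - c t + z) := by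
        simp only [c, Complex.real_smul]; push_cast; ring
      have hwn : ‖w - c t‖ ≤ δ := by rwa [mem_closedBall, dist_eq_norm] at hw
      rw [e]
      refine hB (hy ?_) (hz' ?_) (by linarith [ht.2]) ht.1 (by ring)
      · rw [mem_closedBall, dist_eq_norm]; simpa using hwn
      · rw [mem_closedBall, dist_eq_norm]; simpa using hwn
    have h0 := hz G (hρ.comp (contDiff_id.sub contDiff_const))
      ((isCompact_closedBall _ _).of_isClosed_subset (isClosed_tsupport _) hGs) (hGs.trans hGB) (z - y)
    have e : ∀ w, fderiv ℝ G w = fderiv ℝ ρ (w - c t) := fun w => fderiv_comp_sub (c t)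
    simp_rw [e] at h0
    simp only [F', neg_mul, integral_neg, h0, neg_zero]
  have hconst := constant_of_has_deriv_right_zero (f := fun t => ∫ x, F t x ∂m) (a := 0) (b := 1)
    (fun t _ => (hder t).continuousAt.continuousWithinAt)
    (fun t ht => by
      have := (hder t).hasDerivWithinAt (s := Ici t)
      rwa [hzero t (Ico_subset_Icc_self ht)] at this) 1 (by simp)
  simp only [F, c] at hconst
  simpa using hconst.symm

/-- By Fubini the left side integrates `g` against the mollified distribution, whose density is the
constant `c` on the support of `g`. -/
theorem integral_convolution_comp_mul {m : Measure ℂ} [SFinite m] {u : ℂ → ℂ} {θ : ℂ → ℝ}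
    (hu : AEMeasurable u m) (hθ : Integrable θ m) (ρ : ContDiffBump (0 : ℂ)) {g : ℂ → ℝ}
    (hg : Continuous g) (hgc : HasCompactSupport g) {c : ℝ}
    (hc : ∀ y ∈ tsupport g, ∫ x, ρ.normed volume (u x - y) * θ x ∂m = c) :
    ∫ x, (ρ.normed volume ⋆[ContinuousLinearMap.lsmul ℝ ℝ, volume] g) (u x) * θ x ∂m
      = c * ∫ y, g y := by
  obtain ⟨M, hM0, hM⟩ := exists_bound_of_hasCompactSupport (ρ.continuous_normed (μ := volume))
    ρ.hasCompactSupport_normed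
  have hgi : Integrable g := hg.integrable_of_hasCompactSupport hgc
  have hint : Integrable (Function.uncurry fun x y => ρ.normed volume (u x - y) * g y * θ x)
      (m.prod volume) := by
    have h1 : Integrable (fun p : ℂ × ℂ => θ p.1 * g p.2) (m.prod volume) := hθ.mul_prod hgi
    have h2 : AEMeasurable (fun p : ℂ × ℂ => u p.1 - p.2) (m.prod volume) :=
      hu.comp_fst.sub measurable_snd.aemeasurable
    have h3 := h1.bdd_mul (c := M)
      (f := fun p : ℂ × ℂ => ρ.normed volume (u p.1 - p.2))
      (ρ.continuous_normed.measurable.comp_aemeasurable h2).aestronglyMeasurable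
      (Eventually.of_forall fun p => hM _)
    refine h3.congr (Eventually.of_forall fun p => ?_)
    simp only [Function.uncurry]; ring
  calc _ = ∫ x, (∫ y, ρ.normed volume (u x - y) * g y * θ x) ∂m := by
        refine integral_congr_ae (Eventually.of_forall fun x => ?_)
        simp only
        rw [convolution_eq_swap, integral_mul_const]
        rfl
    _ = ∫ y, ∫ x, ρ.normed volume (u x - y) * g y * θ x ∂m := integral_integral_swap hint
    _ = ∫ y, c * g y := by
        refine integral_congr_ae (Eventually.of_forall fun y => ?_)
        simp only
        have e : ∀ x, ρ.normed volume (u x - y) * g y * θ x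
            = g y * (ρ.normed volume (u x - y) * θ x) := fun x => by ring
        simp_rw [e]
        rw [integral_const_mul]
        by_cases hy : y ∈ tsupport g
        · rw [hc y hy, mul_comm]
        · rw [image_eq_zero_of_notMem_tsupport hy]; simp
    _ = _ := integral_const_mul _ _

theorem tendsto_integral_convolution_comp {m : Measure ℂ} {u : ℂ → ℂ} {θ : ℂ → ℝ}
    (hu : AEMeasurable u m) (hθ : Integrable θ m) {ρ : ℕ → ContDiffBump (0 : ℂ)}
    (hρ : Tendsto (fun n => (ρ n).rOut) atTop (𝓝 0)) {g : ℂ → ℝ}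
    (hg : Continuous g) (hgc : HasCompactSupport g) :
    Tendsto (fun n => ∫ x, ((ρ n).normed volume ⋆[ContinuousLinearMap.lsmul ℝ ℝ, volume] g) (u x)
      * θ x ∂m) atTop (𝓝 (∫ x, g (u x) * θ x ∂m)) := by
  obtain ⟨M, hM0, hM⟩ := exists_bound_of_hasCompactSupport hg hgc
  have hgi : LocallyIntegrable g := hg.locallyIntegrable
  refine tendsto_integral_of_dominated_convergence (fun x => M * ‖θ x‖) (fun n => ?_)
    (hθ.norm.const_mul _) (fun n => Eventually.of_forall fun x => ?_)
    (Eventually.of_forall fun x => ?_)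
  · have hcont : Continuous ((ρ n).normed volume ⋆[ContinuousLinearMap.lsmul ℝ ℝ, volume] g) :=
      (ρ n).hasCompactSupport_normed.continuous_convolution_left _ (ρ n).continuous_normed hgi
    exact (hcont.measurable.comp_aemeasurable hu).aestronglyMeasurable.mul hθ.1
  · rw [norm_mul]
    refine mul_le_mul_of_nonneg_right ?_ (norm_nonneg _)
    refine (norm_integral_le_of_norm_le ((ρ n).integrable_normed.mul_const M)
      (Eventually.of_forall fun t => ?_)).trans_eq ?_
    · simp only [ContinuousLinearMap.lsmul_apply, smul_eq_mul, norm_mul]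
      rw [Real.norm_of_nonneg ((ρ n).nonneg_normed t)]
      exact mul_le_mul_of_nonneg_left (hM _) ((ρ n).nonneg_normed t)
    · rw [integral_mul_const, (ρ n).integral_normed, one_mul]
  · exact (ContDiffBump.convolution_tendsto_right_of_continuous hρ hg (u x)).mul_const _

/-- A distribution `g ↦ ∫ g(u) θ` with vanishing gradient on a ball is a multiple of Lebesgue
measure there. -/
theorem exists_integral_comp_mul_eq_const_mul {m : Measure ℂ} [SFinite m] {u : ℂ → ℂ} {θ : ℂ → ℝ}
    (hu : AEMeasurable u m) (hθ : Integrable θ m) {y₀ : ℂ} {R : ℝ} (hR : 0 < R)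
    (hz : ∀ G : ℂ → ℝ, ContDiff ℝ ∞ G → HasCompactSupport G → tsupport G ⊆ ball y₀ R → ∀ v : ℂ,
      ∫ x, fderiv ℝ G (u x) v * θ x ∂m = 0) :
    ∃ c : ℝ, ∀ g : ℂ → ℝ, Continuous g → HasCompactSupport g → tsupport g ⊆ ball y₀ R →
      ∫ x, g (u x) * θ x ∂m = c * ∫ y, g y := by
  let ρ : ℕ → ContDiffBump (0 : ℂ) := fun n =>
    ⟨1 / ((n : ℝ) + 1) / 2, 1 / ((n : ℝ) + 1), by positivity, half_lt_self (by positivity)⟩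
  have hρ : Tendsto (fun n => (ρ n).rOut) atTop (𝓝 0) :=
    tendsto_one_div_add_atTop_nhds_zero_nat (𝕜 := ℝ)
  have key : ∀ g : ℂ → ℝ, Continuous g → HasCompactSupport g → tsupport g ⊆ ball y₀ R →
      ∀ᶠ n in atTop, ∫ x, ((ρ n).normed volume ⋆[ContinuousLinearMap.lsmul ℝ ℝ, volume] g) (u x)
        * θ x ∂m = (∫ x, (ρ n).normed volume (u x - y₀) * θ x ∂m) * ∫ y, g y := by
    intro g hg hgc hgs
    obtain ⟨δ, hδ, hδB⟩ := hgc.exists_cthickening_subset_open isOpen_ball hgs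
    filter_upwards [hρ.eventually_lt_const hδ, hρ.eventually_lt_const hR] with n h1 h2
    refine integral_convolution_comp_mul hu hθ (ρ n) hg hgc fun y hy => ?_
    refine integral_translate_eq_of_integral_fderiv_eq_zero hu hθ (convex_ball y₀ R) hz
      (ρ n).contDiff_normed (δ := (ρ n).rOut) ?_ ?_ (closedBall_subset_ball h2)
    · rw [(ρ n).tsupport_normed_eq]
    · exact (closedBall_subset_closedBall h1.le).trans ((closedBall_subset_cthickening hy δ).trans hδB)
  let b : ContDiffBump y₀ := ⟨R / 4, R / 2, by positivity, by linarith⟩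
  have hbs : tsupport b ⊆ ball y₀ R := by
    rw [b.tsupport_eq]; exact closedBall_subset_ball (half_lt_self hR)
  have hb : 0 < ∫ y, b y := b.integral_pos
  -- The mollified densities at `y₀` are not known to converge in advance. Cross-multiplying the
  -- identities for `g` and for the fixed bump `b` eliminates them.
  refine ⟨(∫ x, b (u x) * θ x ∂m) / ∫ y, b y, fun g hg hgc hgs => ?_⟩
  have t1 := (tendsto_integral_convolution_comp hu hθ hρ hg hgc).mul_const (∫ y, b y)
  have t2 := (tendsto_integral_convolution_comp hu hθ hρ b.continuous b.hasCompactSupport).mul_const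
    (∫ y, g y)
  have := tendsto_nhds_unique_of_eventuallyEq t1 t2 (by
    filter_upwards [key g hg hgc hgs, key b b.continuous b.hasCompactSupport hbs] with n h1 h2
    rw [h1, h2]; ring)
  field_simp
  exact this

/-! ### The area formula for homeomorphisms of class `W^1_2`, up to a constant -/

/-- Positive and negative parts stand on opposite sides to avoid subtraction in `ℝ≥0∞`. For `c ≥ 0`
the identity bounds the integral of `J⁻` by that of `J⁺` on every set. Since the two parts are never
simultaneously positive, `J⁻` vanishes almost everywhere. -/
theorem ae_nonneg_and_lintegral_abs_eq {A : Set ℂ} (hA : MeasurableSet A) {J : ℂ → ℝ}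
    (hJ : IntegrableOn J A) {c : ℝ} (hc : 0 ≤ c) {V : Set ℂ → ℝ≥0∞}
    (h : ∀ E, MeasurableSet E → E ⊆ A →
      (∫⁻ x in E, ENNReal.ofReal (J x)) + ENNReal.ofReal (-c) * V E
        = (∫⁻ x in E, ENNReal.ofReal (-J x)) + ENNReal.ofReal c * V E) :
    (∀ᵐ x ∂volume.restrict A, 0 ≤ J x) ∧ ∀ E, MeasurableSet E → E ⊆ A →
      ∫⁻ x in E, ENNReal.ofReal |J x| = ENNReal.ofReal c * V E := by
  have hm : AEMeasurable J (volume.restrict A) := hJ.1.aemeasurable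
  rw [ENNReal.ofReal_of_nonpos (neg_nonpos.2 hc)] at h
  simp only [zero_mul, add_zero] at h
  have h1 : ∀ᵐ x ∂volume.restrict A, ENNReal.ofReal (-J x) ≤ ENNReal.ofReal (J x) := by
    refine ae_le_of_forall_setLIntegral_le_of_sigmaFinite₀ hm.neg.ennreal_ofReal
      fun s hs _ => ?_
    rw [Measure.restrict_restrict hs, h _ (hs.inter hA) inter_subset_right]
    exact le_self_add
  have h2 : ∀ᵐ x ∂volume.restrict A, 0 ≤ J x := by
    filter_upwards [h1] with x hx
    by_contra hneg
    push Not at hneg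
    rw [ENNReal.ofReal_of_nonpos hneg.le, nonpos_iff_eq_zero, ENNReal.ofReal_eq_zero] at hx
    linarith
  refine ⟨h2, fun E hE hEA => ?_⟩
  have h3 : ∀ᵐ x ∂volume.restrict E, 0 ≤ J x := ae_restrict_of_ae_restrict_of_subset hEA h2
  have e1 : ∫⁻ x in E, ENNReal.ofReal |J x| = ∫⁻ x in E, ENNReal.ofReal (J x) :=
    lintegral_congr_ae (by filter_upwards [h3] with x hx; rw [abs_of_nonneg hx])
  have e2 : ∫⁻ x in E, ENNReal.ofReal (-J x) = 0 := by
    rw [← lintegral_zero (μ := volume.restrict E)]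
    refine lintegral_congr_ae ?_
    filter_upwards [h3] with x hx
    rw [ENNReal.ofReal_of_nonpos (neg_nonpos.2 hx)]
  rw [e1, h E hE hEA, e2, zero_add]

/-- Replacing `(J, c)` by `(-J, -c)` exchanges the two sides of the hypothesis, so the sign of `c`
is immaterial. -/
theorem ae_mul_nonneg_and_lintegral_abs_eq {A : Set ℂ} (hA : MeasurableSet A) {J : ℂ → ℝ}
    (hJ : IntegrableOn J A) {c : ℝ} {V : Set ℂ → ℝ≥0∞}
    (h : ∀ E, MeasurableSet E → E ⊆ A →
      (∫⁻ x in E, ENNReal.ofReal (J x)) + ENNReal.ofReal (-c) * V E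
        = (∫⁻ x in E, ENNReal.ofReal (-J x)) + ENNReal.ofReal c * V E) :
    (∀ᵐ x ∂volume.restrict A, 0 ≤ c * J x) ∧ ∀ E, MeasurableSet E → E ⊆ A →
      ∫⁻ x in E, ENNReal.ofReal |J x| = ENNReal.ofReal |c| * V E := by
  rcases le_total 0 c with hc | hc
  · obtain ⟨h1, h2⟩ := ae_nonneg_and_lintegral_abs_eq hA hJ hc h
    rw [abs_of_nonneg hc]
    exact ⟨h1.mono fun x hx => mul_nonneg hc hx, h2⟩
  · obtain ⟨h1, h2⟩ := ae_nonneg_and_lintegral_abs_eq hA (J := fun x => -J x) hJ.neg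
      (neg_nonneg.2 hc) (V := V) fun E hE hEA => by
        simp only [neg_neg]; exact (h E hE hEA).symm
    rw [abs_of_nonpos hc]
    refine ⟨h1.mono fun x hx => ?_, fun E hE hEA => by simpa using h2 E hE hEA⟩
    nlinarith

/-- Injectivity enters here: on `A`, the preimage of `φ '' E` is `E`, so nothing is counted twice or
cancelled. -/
theorem map_withDensity_image {φ : OpenPartialHomeomorph ℂ ℂ} {A E : Set ℂ}
    (hA : MeasurableSet A) (hAs : A ⊆ φ.source) (hE : MeasurableSet E) (hEA : E ⊆ A)
    (k : ℂ → ℝ≥0∞) :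
    ((volume.restrict A).withDensity k).map φ (φ '' E) = ∫⁻ x in E, k x := by
  have hφ : AEMeasurable φ ((volume.restrict A).withDensity k) :=
    ((φ.continuousOn.mono hAs).aemeasurable hA).mono_ac (withDensity_absolutelyContinuous _ _)
  have hS : MeasurableSet (φ '' E) := hE.image_of_continuousOn_injOn
    (φ.continuousOn.mono (hEA.trans hAs)) (φ.injOn.mono (hEA.trans hAs))
  have hmem : ∀ᵐ x ∂(volume.restrict A).withDensity k, x ∈ A :=
    (withDensity_absolutelyContinuous _ _).ae_le (ae_restrict_mem hA)
  rw [Measure.map_apply_of_aemeasurable hφ hS]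
  have : (φ ⁻¹' (φ '' E) : Set ℂ) =ᵐ[(volume.restrict A).withDensity k] E := by
    filter_upwards [hmem] with x hx
    refine propext ⟨fun h => ?_, fun h => mem_image_of_mem _ h⟩
    obtain ⟨z, hz, hzx⟩ := h
    exact φ.injOn (hAs (hEA hz)) (hAs hx) hzx ▸ hz
  rw [measure_congr this, withDensity_apply _ hE, Measure.restrict_restrict hE,
    inter_eq_left.2 hEA]

theorem integral_map_withDensity_ofReal {φ : OpenPartialHomeomorph ℂ ℂ} {A : Set ℂ}
    (hA : MeasurableSet A) (hAs : A ⊆ φ.source) {J : ℂ → ℝ} (hJ : IntegrableOn J A) {g : ℂ → ℝ}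
    (hg : Continuous g) :
    ∫ y, g y ∂((volume.restrict A).withDensity fun x => ENNReal.ofReal (J x)).map φ
      = ∫ x in A, g (φ x) * max (J x) 0 := by
  have hφ : AEMeasurable φ ((volume.restrict A).withDensity fun x => ENNReal.ofReal (J x)) :=
    ((φ.continuousOn.mono hAs).aemeasurable hA).mono_ac (withDensity_absolutelyContinuous _ _)
  rw [integral_map hφ hg.aestronglyMeasurable, integral_withDensity_eq_integral_toReal_smul₀
    hJ.1.aemeasurable.ennreal_ofReal (by simp)]
  refine integral_congr_ae (Eventually.of_forall fun x => ?_)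
  simp only [smul_eq_mul, ENNReal.toReal_ofReal']
  ring

theorem isFiniteMeasure_map_withDensity_ofReal {φ : ℂ → ℂ} {A : Set ℂ} {J : ℂ → ℝ}
    (hJ : IntegrableOn J A) :
    IsFiniteMeasure (((volume.restrict A).withDensity fun x => ENNReal.ofReal (J x)).map φ) := by
  have := isFiniteMeasure_withDensity_ofReal (μ := volume.restrict A) hJ.2
  infer_instance

/-- If the distributional push-forward of `J dx` is a multiple of Lebesgue measure on a ball, so is
the push-forward measure. -/
theorem lintegral_add_eq_of_integral_comp_eq (φ : OpenPartialHomeomorph ℂ ℂ) {B : Set ℂ}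
    (hBo : IsOpen B) (hBf : volume B ≠ ⊤) {J : ℂ → ℝ}
    (hJ : IntegrableOn J (φ.source ∩ φ ⁻¹' B)) {c : ℝ}
    (hc : ∀ g : ℂ → ℝ, Continuous g → HasCompactSupport g → tsupport g ⊆ B →
      ∫ x in φ.source ∩ φ ⁻¹' B, g (φ x) * J x = c * ∫ y, g y)
    {E : Set ℂ} (hE : MeasurableSet E) (hEA : E ⊆ φ.source ∩ φ ⁻¹' B) :
    (∫⁻ x in E, ENNReal.ofReal (J x)) + ENNReal.ofReal (-c) * volume (φ '' E)
      = (∫⁻ x in E, ENNReal.ofReal (-J x)) + ENNReal.ofReal c * volume (φ '' E) := by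
  set A := φ.source ∩ φ ⁻¹' B with hAdef
  have hA : MeasurableSet A := (φ.isOpen_inter_preimage hBo).measurableSet
  have hAs : A ⊆ φ.source := inter_subset_left
  have : IsFiniteMeasure (volume.restrict B) := isFiniteMeasure_restrict.2 hBf
  have hJn : IntegrableOn (fun x => -J x) A := hJ.neg
  have := isFiniteMeasure_map_withDensity_ofReal (φ := φ) hJ
  have := isFiniteMeasure_map_withDensity_ofReal (φ := φ) hJn
  set ν₁ := ((volume.restrict A).withDensity fun x => ENNReal.ofReal (J x)).map φ with hν₁
  set ν₂ := ((volume.restrict A).withDensity fun x => ENNReal.ofReal (-J x)).map φ with hν₂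
  have hfin : ∀ t : ℝ, IsFiniteMeasure (ENNReal.ofReal t • volume.restrict B) := fun t =>
    Measure.smul_finite _ ENNReal.ofReal_ne_top
  have := hfin c
  have := hfin (-c)
  -- The signed identity `φ_*(J dx) = c dy` is rearranged into an equality of finite positive
  -- measures, which test functions determine.
  have key : (ν₁ + ENNReal.ofReal (-c) • volume.restrict B).restrict B
      = (ν₂ + ENNReal.ofReal c • volume.restrict B).restrict B := by
    refine restrict_eq_of_integral_contDiff_eq hBo fun g hg hgc hgB => ?_
    have hgb : ∃ M, ∀ x, ‖g x‖ ≤ M := hg.continuous.bounded_above_of_compact_support hgc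
    obtain ⟨M, hM⟩ := hgb
    have hgi : ∀ (ν : Measure ℂ) [IsFiniteMeasure ν], Integrable g ν := fun ν _ =>
      Integrable.of_bound hg.continuous.aestronglyMeasurable M (Eventually.of_forall hM)
    rw [integral_add_measure (hgi _) (hgi _), integral_add_measure (hgi _) (hgi _),
      integral_smul_measure, integral_smul_measure, hν₁, hν₂,
      integral_map_withDensity_ofReal hA hAs hJ hg.continuous,
      integral_map_withDensity_ofReal hA hAs hJn hg.continuous]
    have hgB' : ∫ y in B, g y = ∫ y, g y :=
      setIntegral_eq_integral_of_forall_compl_eq_zero fun y hy =>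
        image_eq_zero_of_notMem_tsupport fun h => hy (hgB h)
    have hgm : AEStronglyMeasurable (fun x => g (φ x)) (volume.restrict A) :=
      (hg.continuous.comp_continuousOn (φ.continuousOn.mono hAs)).aestronglyMeasurable hA
    have hi : ∀ {k : ℂ → ℝ}, IntegrableOn k A → IntegrableOn (fun x => g (φ x) * max (k x) 0) A :=
      fun hk => (Integrable.pos_part hk).bdd_mul (c := M) hgm (Eventually.of_forall fun x => hM _)
    have h1 := hc g hg.continuous hgc hgB
    have h2 : ∫ x in A, g (φ x) * J x
        = (∫ x in A, g (φ x) * max (J x) 0) - ∫ x in A, g (φ x) * max (-J x) 0 := by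
      rw [← integral_sub (hi hJ) (hi hJn)]
      refine integral_congr_ae (Eventually.of_forall fun x => ?_)
      have : J x = max (J x) 0 - max (-J x) 0 := by
        rcases le_total 0 (J x) with h | h
        · rw [max_eq_left h, max_eq_right (by linarith), sub_zero]
        · rw [max_eq_right h, max_eq_left (by linarith)]; ring
      simp only
      rw [← mul_sub, ← this]
    rw [hgB']
    simp only [ENNReal.toReal_ofReal', smul_eq_mul]
    have hcc : c = max c 0 - max (-c) 0 := by
      rcases le_total 0 c with h | h
      · rw [max_eq_left h, max_eq_right (by linarith), sub_zero]
      · rw [max_eq_right h, max_eq_left (by linarith)]; ring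
    have h3 : c * ∫ y, g y = (max c 0) * (∫ y, g y) - max (-c) 0 * ∫ y, g y := by
      rw [← sub_mul, ← hcc]
    linarith
  have hS : MeasurableSet (φ '' E) := hE.image_of_continuousOn_injOn
    (φ.continuousOn.mono (hEA.trans hAs)) (φ.injOn.mono (hEA.trans hAs))
  have hSB : φ '' E ⊆ B := by
    rintro _ ⟨x, hx, rfl⟩; exact (hEA hx).2
  have := congrArg (fun ν : Measure ℂ => ν (φ '' E)) key
  simp only [Measure.restrict_apply hS, inter_eq_left.2 hSB, Measure.add_apply, Measure.smul_apply,
    smul_eq_mul] at this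
  rwa [hν₁, hν₂, map_withDensity_image hA hAs hE hEA, map_withDensity_image hA hAs hE hEA] at this

theorem integrableOn_det_of_closedBall_subset (φ : OpenPartialHomeomorph ℂ ℂ)
    {D : ℂ → ℂ →L[ℝ] ℂ}
    (hD : ∀ C : Set ℂ, IsCompact C → C ⊆ φ.source → MemLp D 2 (volume.restrict C))
    {y₀ : ℂ} {R : ℝ} (hB : closedBall y₀ R ⊆ φ.target) :
    IntegrableOn (fun x => (D x).det) (φ.source ∩ φ ⁻¹' ball y₀ R) := by
  have hC : IsCompact (φ.symm '' closedBall y₀ R) :=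
    (isCompact_closedBall y₀ R).image_of_continuousOn (φ.continuousOn_symm.mono hB)
  refine IntegrableOn.mono_set
    (MemLp.integrable_det (hD _ hC (symm_image_subset_source φ hB))) fun x hx => ?_
  exact ⟨φ x, ball_subset_closedBall hx.2, φ.left_inv hx.1⟩

theorem setIntegral_source_comp_mul (φ : OpenPartialHomeomorph ℂ ℂ) {B : Set ℂ}
    {g : ℂ → ℝ} (hg : tsupport g ⊆ B) (k : ℂ → ℝ) :
    ∫ x in φ.source, g (φ x) * k x = ∫ x in φ.source ∩ φ ⁻¹' B, g (φ x) * k x := by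
  refine setIntegral_eq_of_subset_of_forall_sdiff_eq_zero φ.open_source.measurableSet
    inter_subset_left fun x hx => ?_
  rw [image_eq_zero_of_notMem_tsupport fun h => hx.2 ⟨hx.1, hg h⟩, zero_mul]

/-- The area formula over a ball, up to a constant factor. -/
theorem exists_area_formula (φ : OpenPartialHomeomorph ℂ ℂ) {D : ℂ → ℂ →L[ℝ] ℂ}
    (hu : HasWeakFDeriv φ.source φ D)
    (hD : ∀ C : Set ℂ, IsCompact C → C ⊆ φ.source → MemLp D 2 (volume.restrict C))
    {y₀ : ℂ} {R : ℝ} (hR : 0 < R) (hB : closedBall y₀ R ⊆ φ.target) :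
    ∃ c : ℝ,
      (∀ g : ℂ → ℝ, Continuous g → HasCompactSupport g → tsupport g ⊆ ball y₀ R →
        ∫ x in φ.source, g (φ x) * (D x).det = c * ∫ y, g y) ∧
      (∀ᵐ x ∂volume.restrict (φ.source ∩ φ ⁻¹' ball y₀ R), 0 ≤ c * (D x).det) ∧
      ∀ E, MeasurableSet E → E ⊆ φ.source ∩ φ ⁻¹' ball y₀ R →
        ∫⁻ x in E, ENNReal.ofReal |(D x).det| = ENNReal.ofReal |c| * volume (φ '' E) := by
  have hJ := integrableOn_det_of_closedBall_subset φ hD hB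
  have hBt : ball y₀ R ⊆ φ.target := ball_subset_closedBall.trans hB
  have hA : MeasurableSet (φ.source ∩ φ ⁻¹' ball y₀ R) :=
    (φ.isOpen_inter_preimage isOpen_ball).measurableSet
  obtain ⟨c, hc⟩ := exists_integral_comp_mul_eq_const_mul
    (m := volume.restrict (φ.source ∩ φ ⁻¹' ball y₀ R)) (u := φ)
    ((φ.continuousOn.mono inter_subset_left).aemeasurable hA) hJ (y₀ := y₀) hR
    fun G hG hGc hGB v => by
      -- The constant weight has zero gradient, so the right-hand side disappears.
      have h := integral_mul_det_mul_fderiv_comp φ hu hD hG hGc (hGB.trans hBt)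
        (p := fun _ => 1) contDiff_const v
      rw [← setIntegral_source_comp_mul φ (g := fun y => fderiv ℝ G y v)
        ((tsupport_fderiv_apply_subset ℝ v).trans hGB)]
      simp only [one_mul, fderiv_fun_const, Pi.zero_apply, zero_apply, mul_zero,
        integral_zero, neg_zero] at h
      simpa only [mul_comm] using h
  obtain ⟨h1, h2⟩ := ae_mul_nonneg_and_lintegral_abs_eq hA hJ (c := c)
    (V := fun E => volume (φ '' E)) fun E hE hEA =>
      lintegral_add_eq_of_integral_comp_eq φ isOpen_ball measure_ball_lt_top.ne hJ hc hE hEA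
  refine ⟨c, fun g hg hgc hgB => ?_, h1, h2⟩
  rw [setIntegral_source_comp_mul φ hgB]
  exact hc g hg hgc hgB

/-! ### The constant in the area formula is at least one -/

/-- The determinant is quadratic, so `|det P - det D| ≤ |P - D|² + 2 |P - D| |D|`; Cauchy–Schwarz
turns `L²` convergence of differentials into `L¹` convergence of Jacobians. -/
theorem tendsto_lintegral_det_sub {μ : Measure ℂ} {D : ℂ → ℂ →L[ℝ] ℂ} (hD : MemLp D 2 μ)
    {P : ℕ → ℂ → ℂ →L[ℝ] ℂ} (hP : ∀ n, AEStronglyMeasurable (P n) μ)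
    (h : Tendsto (fun n => eLpNorm (fun x => P n x - D x) 2 μ) atTop (𝓝 0)) :
    Tendsto (fun n => ∫⁻ x, ‖(P n x).det - (D x).det‖ₑ ∂μ) atTop (𝓝 0) := by
  have hm : ∀ n, AEStronglyMeasurable (fun x => P n x - D x) μ := fun n => (hP n).sub hD.1
  have hlim : Tendsto (fun n => eLpNorm (fun x => P n x - D x) 2 μ *
      eLpNorm (fun x => P n x - D x) 2 μ
      + 2 * (eLpNorm (fun x => P n x - D x) 2 μ * eLpNorm D 2 μ)) atTop (𝓝 0) := by
    have h1 := ENNReal.Tendsto.mul h (Or.inr ENNReal.zero_ne_top) h (Or.inr ENNReal.zero_ne_top)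
    have h2 := ENNReal.Tendsto.const_mul (a := 2)
      (ENNReal.Tendsto.mul_const (b := eLpNorm D 2 μ) h (Or.inr hD.2.ne)) (Or.inr (by simp))
    simpa using h1.add h2
  refine tendsto_of_tendsto_of_tendsto_of_le_of_le tendsto_const_nhds hlim (fun _ => zero_le)
    fun n => ?_
  have hb : ∀ x, ‖(P n x).det - (D x).det‖ₑ
      ≤ ‖P n x - D x‖ₑ * ‖P n x - D x‖ₑ + 2 * (‖P n x - D x‖ₑ * ‖D x‖ₑ) := by
    intro x
    have h1 := abs_det_sub_le (P n x) (D x)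
    have h2 : ‖P n x‖ ≤ ‖P n x - D x‖ + ‖D x‖ := norm_le_norm_sub_add _ _
    have h3 : |(P n x).det - (D x).det|
        ≤ ‖P n x - D x‖ * ‖P n x - D x‖ + 2 * (‖P n x - D x‖ * ‖D x‖) := by
      nlinarith [norm_nonneg (P n x - D x)]
    have h4 := ENNReal.ofReal_le_ofReal h3
    rw [ENNReal.ofReal_add (by positivity) (by positivity), ENNReal.ofReal_mul (by positivity),
      ENNReal.ofReal_mul (by norm_num), ENNReal.ofReal_mul (by positivity), ofReal_norm,
      ofReal_norm] at h4
    rw [← ofReal_norm]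
    simpa using h4
  refine (lintegral_mono hb).trans ?_
  have hmm : AEMeasurable (fun x => ‖P n x - D x‖ₑ * ‖P n x - D x‖ₑ) μ :=
    (hm n).enorm.mul (hm n).enorm
  rw [lintegral_add_left' hmm, lintegral_const_mul' _ _ (by simp)]
  gcongr
  · exact lintegral_enorm_mul_enorm_le (hm n) (hm n)
  · exact lintegral_enorm_mul_enorm_le (hm n) hD.1

/-- A map of nonzero degree is onto: a bump around an omitted point would be invisible on the left
and have nonzero integral on the right. -/
theorem ball_subset_image_of_integral_comp_eq {C : Set ℂ} (hC : IsCompact C) {w : ℂ → ℂ}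
    (hw : Continuous w) {θ : ℂ → ℝ} {y₀ : ℂ} {a c : ℝ} (hc0 : c ≠ 0)
    (hc : ∀ g : ℂ → ℝ, Continuous g → HasCompactSupport g → tsupport g ⊆ ball y₀ a →
      ∫ x in C, g (w x) * θ x = c * ∫ y, g y) : ball y₀ a ⊆ w '' C := by
  intro y hy
  by_contra hyC
  have hopen : IsOpen (ball y₀ a \ w '' C) := isOpen_ball.sdiff (hC.image hw).isClosed
  obtain ⟨r, hr, hrs⟩ := Metric.isOpen_iff.1 hopen y ⟨hy, hyC⟩
  let b : ContDiffBump y := ⟨r / 4, r / 2, by positivity, by linarith⟩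
  have hbs : tsupport b ⊆ ball y₀ a \ w '' C := by
    rw [b.tsupport_eq]
    exact (closedBall_subset_ball (half_lt_self hr)).trans hrs
  have h1 := hc b b.continuous b.hasCompactSupport (hbs.trans sdiff_subset)
  have h2 : ∫ x in C, b (w x) * θ x = 0 := by
    rw [setIntegral_eq_zero_of_forall_eq_zero]
    intro x hx
    rw [image_eq_zero_of_notMem_tsupport fun h => (hbs h).2 (mem_image_of_mem w hx), zero_mul]
  rw [h2] at h1
  exact (mul_ne_zero hc0 (b.integral_pos (μ := volume)).ne') h1.symm

/-- Smooth approximants, cut off by `χ`, have a constant degree over the ball of radius `a`. These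
degrees approach `c ≠ 0`, so eventually the approximants cover that ball. The area they sweep is at
most `∫_C |det|`, which tends to at most `|c|` times the area of the ball of radius `b`. -/
theorem volume_ball_le_of_area_formula (φ : OpenPartialHomeomorph ℂ ℂ) {D : ℂ → ℂ →L[ℝ] ℂ}
    (hu : HasWeakFDeriv φ.source φ D)
    (hD : ∀ C : Set ℂ, IsCompact C → C ⊆ φ.source → MemLp D 2 (volume.restrict C))
    {y₀ : ℂ} {R : ℝ} (hB : closedBall y₀ R ⊆ φ.target) {c : ℝ} (hc0 : c ≠ 0)
    (hc : ∀ g : ℂ → ℝ, Continuous g → HasCompactSupport g → tsupport g ⊆ ball y₀ R →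
        ∫ x in φ.source, g (φ x) * (D x).det = c * ∫ y, g y)
    (harea : ∀ E, MeasurableSet E → E ⊆ φ.source ∩ φ ⁻¹' ball y₀ R →
        ∫⁻ x in E, ENNReal.ofReal |(D x).det| = ENNReal.ofReal |c| * volume (φ '' E))
    {a b : ℝ} (ha : 0 < a) (hab : a < b) (hbR : b < R) :
    volume (ball y₀ a) ≤ ENNReal.ofReal |c| * volume (ball y₀ b) := by
  have hBt : ball y₀ R ⊆ φ.target := ball_subset_closedBall.trans hB
  -- An intermediate radius: `χ` is `1` near the preimage of the closed `d`-ball and is supported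
  -- over the `b`-ball.
  set d := (a + b) / 2 with hd
  have hdt : closedBall y₀ d ⊆ φ.target :=
    (closedBall_subset_ball (by linarith)).trans hBt
  set W := φ.symm '' closedBall y₀ d with hW
  have hWc : IsCompact W :=
    (isCompact_closedBall y₀ d).image_of_continuousOn (φ.continuousOn_symm.mono hdt)
  have hWU : W ⊆ φ.source ∩ φ ⁻¹' ball y₀ b := by
    rintro _ ⟨y, hy, rfl⟩
    refine ⟨φ.map_target (hdt hy), ?_⟩
    rw [mem_preimage, φ.right_inv (hdt hy)]
    exact closedBall_subset_ball (by linarith) hy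
  obtain ⟨χ, hχ, hχc, hχs, hχ1, hχ01⟩ := exists_contDiff_one_nhds hWc
    (φ.isOpen_inter_preimage isOpen_ball) hWU
  set C := tsupport χ with hCdef
  have hCc : IsCompact C := hχc
  have hCs : C ⊆ φ.source := hχs.trans inter_subset_left
  set μ := volume.restrict C with hμ
  have : IsFiniteMeasure μ := isFiniteMeasure_restrict.2 hCc.measure_lt_top.ne
  have hD2 : MemLp D 2 μ := hD C hCc hCs
  have hJ : Integrable (fun x => (D x).det) μ := MemLp.integrable_det hD2
  obtain ⟨w, hw, hwu, hwD⟩ := hu.exists_seq_approx φ.open_source φ.continuousOn hD hCc hCs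
  have hw' : ∀ n, Continuous (fderiv ℝ (w n)) := fun n => (hw n).continuous_fderiv (by simp)
  have hdetlim := tendsto_lintegral_det_sub hD2 (P := fun n => fderiv ℝ (w n))
    (fun n => (hw' n).aestronglyMeasurable) hwD
  have hdetc : ∀ n, Continuous fun x => (fderiv ℝ (w n) x).det := fun n =>
    continuous_det.comp (hw' n)
  have hθi : ∀ n, Integrable (fun x => χ x * (fderiv ℝ (w n) x).det) μ := fun n =>
    (hχ.continuous.mul (hdetc n)).continuousOn.integrableOn_compact hCc
  -- for large `n` the approximating maps have constant degree on the small ball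
  have hdeg : ∀ᶠ n in atTop, ∃ cn : ℝ, ∀ g : ℂ → ℝ, Continuous g → HasCompactSupport g →
      tsupport g ⊆ ball y₀ a →
      ∫ x in C, g (w n x) * (χ x * (fderiv ℝ (w n) x).det) = cn * ∫ y, g y := by
    -- The tolerance is `d - a`. Points outside `W` have `φ x` beyond distance `d` of `y₀`, so `w n
    -- x` misses the `a`-ball and the term containing the gradient of `χ` drops out.
    filter_upwards [hwu ((b - a) / 2) (by linarith)] with n hn
    refine exists_integral_comp_mul_eq_const_mul (m := μ) (hw n).continuous.measurable.aemeasurable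
      (hθi n) ha fun G hG hGc hGB v => ?_
    have h0 := (hasWeakFDeriv_of_contDiff (hw n)).integral_comp_mul_fderiv_adj_add isOpen_univ
      (hw n).continuous.continuousOn (fun K hK _ => ?_) hG hGc hχ hχc (subset_univ _) v
    · rw [← h0]
      refine setIntegral_congr_fun hCc.measurableSet fun x hx => ?_
      have hz : G (w n x) * fderiv ℝ χ x (adj (fderiv ℝ (w n) x) v) = 0 := by
        by_cases hxW : x ∈ W
        · have h1 : fderiv ℝ χ x = 0 := by
            rw [(hχ1 x hxW).fderiv_eq]
            exact fderiv_const_apply _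
          rw [h1]; simp
        · have h1 : φ x ∉ closedBall y₀ d := fun h => hxW ⟨φ x, h, φ.left_inv (hCs hx)⟩
          have h2 : w n x ∉ ball y₀ a := by
            intro h
            rw [mem_closedBall, not_le] at h1
            have h3 := dist_triangle (φ x) (w n x) y₀
            have h4 := hn x hx
            rw [dist_comm] at h4
            rw [mem_ball] at h
            linarith
          rw [image_eq_zero_of_notMem_tsupport fun h => h2 (hGB h), zero_mul]
      rw [hz]; ring
    · have : IsFiniteMeasure (volume.restrict K) :=
        isFiniteMeasure_restrict.2 hK.measure_lt_top.ne
      obtain ⟨M, hM⟩ := hK.exists_bound_of_continuousOn (hw' n).continuousOn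
      refine MemLp.of_bound (hw' n).aestronglyMeasurable M ?_
      filter_upwards [ae_restrict_mem hK.measurableSet] with x hx using hM x hx
  -- the degrees converge to `c`
  let β : ContDiffBump y₀ := ⟨a / 4, a / 2, by positivity, by linarith⟩
  have hβs : tsupport β ⊆ ball y₀ a := by
    rw [β.tsupport_eq]; exact closedBall_subset_ball (half_lt_self ha)
  have hβpos : 0 < ∫ y, β y := β.integral_pos
  have hβ1 : ∀ y, ‖β y‖ ≤ 1 := fun y => by
    rw [Real.norm_of_nonneg β.nonneg]; exact β.le_one
  have hχ1' : ∀ x, ‖χ x‖ ≤ 1 := fun x => by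
    rw [Real.norm_of_nonneg (hχ01 x).1]; exact (hχ01 x).2
  have hmul : ∀ (y x : ℂ) (t : ℝ), ‖β y * (χ x * t)‖ ≤ ‖t‖ := fun y x t => by
    rw [norm_mul, norm_mul]
    exact (mul_le_of_le_one_left (by positivity) (hβ1 y)).trans
      (mul_le_of_le_one_left (norm_nonneg t) (hχ1' x))
  have hlim1 : Tendsto (fun n => ∫ x in C, β (w n x) * (χ x * (D x).det)) atTop
      (𝓝 (∫ x in C, β (φ x) * (χ x * (D x).det))) := by
    refine tendsto_integral_of_dominated_convergence (fun x => ‖(D x).det‖) (fun n => ?_)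
      hJ.norm (fun n => Eventually.of_forall fun x => ?_) ?_
    · exact (β.continuous.comp (hw n).continuous).aestronglyMeasurable.mul
        (hχ.continuous.aestronglyMeasurable.mul hJ.1)
    · exact hmul _ _ _
    · filter_upwards [ae_restrict_mem hCc.measurableSet] with x hx
      refine Tendsto.mul_const _ ((β.continuous.tendsto (φ x)).comp ?_)
      rw [Metric.tendsto_nhds]
      intro ε hε
      filter_upwards [hwu (ε / 2) (by positivity)] with n hn
      exact (hn x hx).trans_lt (by linarith)
  have hlim2 : Tendsto (fun n => ∫ x in C, β (w n x) * (χ x * ((fderiv ℝ (w n) x).det - (D x).det)))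
      atTop (𝓝 0) := by
    rw [tendsto_iff_edist_tendsto_0]
    refine tendsto_of_tendsto_of_tendsto_of_le_of_le tendsto_const_nhds hdetlim
      (fun _ => zero_le) fun n => ?_
    simp only [edist_zero_right]
    refine (enorm_integral_le_lintegral_enorm _).trans (lintegral_mono fun x => ?_)
    rw [enorm_le_iff_norm_le]
    exact hmul _ _ _
  have hval : ∫ x in C, β (φ x) * (χ x * (D x).det) = c * ∫ y, β y := by
    rw [← hc β β.continuous β.hasCompactSupport (hβs.trans (ball_subset_ball (by linarith))),
      ← setIntegral_eq_of_subset_of_forall_sdiff_eq_zero φ.open_source.measurableSet hCs]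
    · refine setIntegral_congr_fun φ.open_source.measurableSet fun x hx => ?_
      by_cases hxW : x ∈ W
      · have h1 : χ x = 1 := (hχ1 x hxW).eq_of_nhds
        rw [h1, one_mul]
      · have h1 : φ x ∉ closedBall y₀ d := fun h => hxW ⟨φ x, h, φ.left_inv hx⟩
        have h2 : β (φ x) = 0 := image_eq_zero_of_notMem_tsupport fun h => h1
          (ball_subset_closedBall (ball_subset_ball (by linarith) (hβs h)))
        rw [h2]; ring
    · intro x hx
      rw [image_eq_zero_of_notMem_tsupport hx.2]; ring
  have hlim : Tendsto (fun n => ∫ x in C, β (w n x) * (χ x * (fderiv ℝ (w n) x).det)) atTop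
      (𝓝 (c * ∫ y, β y)) := by
    have := hlim1.add hlim2
    rw [hval, add_zero] at this
    refine this.congr fun n => ?_
    have hβm : AEStronglyMeasurable (fun x => β (w n x)) μ :=
      (β.continuous.comp (hw n).continuous).aestronglyMeasurable
    have hi1 : Integrable (fun x => β (w n x) * (χ x * (D x).det)) μ :=
      (hJ.bdd_mul (c := 1) hχ.continuous.aestronglyMeasurable
        (Eventually.of_forall hχ1')).bdd_mul (c := 1) hβm (Eventually.of_forall fun x => hβ1 _)
    have hi2 : Integrable (fun x => β (w n x) * (χ x * (fderiv ℝ (w n) x).det)) μ :=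
      (hθi n).bdd_mul (c := 1) hβm (Eventually.of_forall fun x => hβ1 _)
    have hi3 : Integrable (fun x => β (w n x) * (χ x * ((fderiv ℝ (w n) x).det - (D x).det))) μ := by
      refine (hi2.sub hi1).congr (Eventually.of_forall fun x => ?_)
      simp only [Pi.sub_apply]; ring
    rw [← integral_add hi1 hi3]
    refine integral_congr_ae (Eventually.of_forall fun x => ?_)
    simp only; ring
  have hne : ∀ᶠ n in atTop, ∫ x in C, β (w n x) * (χ x * (fderiv ℝ (w n) x).det) ≠ 0 :=
    hlim.eventually_ne (mul_ne_zero hc0 hβpos.ne')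
  -- compare areas
  have harea' : ∀ᶠ n in atTop, volume (ball y₀ a)
      ≤ ENNReal.ofReal |c| * volume (ball y₀ b)
        + ∫⁻ x, ‖(fderiv ℝ (w n) x).det - (D x).det‖ₑ ∂μ := by
    filter_upwards [hdeg, hne] with n hn hne
    obtain ⟨cn, hcn⟩ := hn
    have hcn0 : cn ≠ 0 := by
      rintro rfl
      rw [hcn β β.continuous β.hasCompactSupport hβs, zero_mul] at hne
      exact hne rfl
    have hsub := ball_subset_image_of_integral_comp_eq hCc (hw n).continuous hcn0 hcn
    -- This half of the area formula needs no injectivity, which the approximants may lack.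
    have h1 : volume (w n '' C) ≤ ∫⁻ x in C, ENNReal.ofReal |(fderiv ℝ (w n) x).det| :=
      addHaar_image_le_lintegral_abs_det_fderiv volume hCc.measurableSet fun x _ =>
        ((hw n).differentiable (by simp) x).hasFDerivAt.hasFDerivWithinAt
    have h2 : ∫⁻ x in C, ENNReal.ofReal |(fderiv ℝ (w n) x).det|
        ≤ ∫⁻ x in C, (ENNReal.ofReal |(D x).det| + ‖(fderiv ℝ (w n) x).det - (D x).det‖ₑ) := by
      refine lintegral_mono fun x => ?_
      rw [← ofReal_norm, ← ENNReal.ofReal_add (abs_nonneg _) (norm_nonneg _), Real.norm_eq_abs]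
      refine ENNReal.ofReal_le_ofReal ?_
      have := abs_add_le (D x).det ((fderiv ℝ (w n) x).det - (D x).det)
      rwa [add_sub_cancel] at this
    have h3 : ∫⁻ x in C, ENNReal.ofReal |(D x).det| ≤ ENNReal.ofReal |c| * volume (ball y₀ b) := by
      rw [harea C hCc.measurableSet (hχs.trans
        (inter_subset_inter_right _ (preimage_mono (ball_subset_ball hbR.le))))]
      gcongr
      rintro _ ⟨x, hx, rfl⟩
      exact (hχs hx).2
    have hJm : AEMeasurable (fun x => ENNReal.ofReal |(D x).det|) μ :=
      hJ.1.norm.aemeasurable.ennreal_ofReal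
    rw [lintegral_add_left' hJm] at h2
    exact (measure_mono hsub).trans (h1.trans (h2.trans (by gcongr)))
  have hfinal := (hdetlim.const_add (ENNReal.ofReal |c| * volume (ball y₀ b)))
  rw [add_zero] at hfinal
  exact ge_of_tendsto hfinal harea'

/-- Radii `t R / 2` and `R / 2` give `t² ≤ |c|`; then `t` tends to `1`. -/
theorem one_le_abs_of_area_formula (φ : OpenPartialHomeomorph ℂ ℂ) {D : ℂ → ℂ →L[ℝ] ℂ}
    (hu : HasWeakFDeriv φ.source φ D)
    (hD : ∀ C : Set ℂ, IsCompact C → C ⊆ φ.source → MemLp D 2 (volume.restrict C))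
    {y₀ : ℂ} {R : ℝ} (hR : 0 < R) (hB : closedBall y₀ R ⊆ φ.target) {c : ℝ} (hc0 : c ≠ 0)
    (hc : ∀ g : ℂ → ℝ, Continuous g → HasCompactSupport g → tsupport g ⊆ ball y₀ R →
        ∫ x in φ.source, g (φ x) * (D x).det = c * ∫ y, g y)
    (harea : ∀ E, MeasurableSet E → E ⊆ φ.source ∩ φ ⁻¹' ball y₀ R →
        ∫⁻ x in E, ENNReal.ofReal |(D x).det| = ENNReal.ofReal |c| * volume (φ '' E)) :
    1 ≤ |c| := by
  have key : ∀ t ∈ Ioo (0 : ℝ) 1, t ^ 2 ≤ |c| := by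
    intro t ht
    have hb : 0 < R / 2 := by positivity
    have h := volume_ball_le_of_area_formula φ hu hD hB hc0 hc harea (a := t * (R / 2)) (b := R / 2)
      (mul_pos ht.1 hb) (by nlinarith [ht.2]) (half_lt_self hR)
    rw [Complex.volume_ball, Complex.volume_ball, ← mul_assoc] at h
    have h' := (ENNReal.mul_le_mul_iff_left (by simp [NNReal.pi_ne_zero]) (by simp)).1 h
    rw [← ENNReal.ofReal_pow (by nlinarith [ht.1]), ← ENNReal.ofReal_pow hb.le,
      ← ENNReal.ofReal_mul (abs_nonneg c), ENNReal.ofReal_le_ofReal_iff (by positivity), mul_pow] at h'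
    exact le_of_mul_le_mul_right h' (by positivity)
  have hlim : Tendsto (fun t : ℝ => t ^ 2) (𝓝[<] 1) (𝓝 1) := by
    have : Continuous fun t : ℝ => t ^ 2 := by fun_prop
    simpa using (this.tendsto 1).mono_left nhdsWithin_le_nhds
  refine le_of_tendsto hlim ?_
  filter_upwards [Ioo_mem_nhdsLT (show (0 : ℝ) < 1 by norm_num)] with t ht using key t ht

/-! ### The area formula on the whole domain -/

/-- The disc is exhausted by concentric balls whose closures lie inside it. All their constants
coincide, being determined by one bump supported in the smallest ball. -/
theorem exists_area_formula_of_target_eq_ball (φ : OpenPartialHomeomorph ℂ ℂ)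
    {D : ℂ → ℂ →L[ℝ] ℂ} (hu : HasWeakFDeriv φ.source φ D)
    (hD : ∀ C : Set ℂ, IsCompact C → C ⊆ φ.source → MemLp D 2 (volume.restrict C))
    {y₀ : ℂ} {R : ℝ} (hR : 0 < R) (ht : φ.target = ball y₀ R) :
    ∃ c : ℝ, (c ≠ 0 → 1 ≤ |c|) ∧ (∀ᵐ x ∂volume.restrict φ.source, 0 ≤ c * (D x).det) ∧
      ∀ E, MeasurableSet E → E ⊆ φ.source →
        ∫⁻ x in E, ENNReal.ofReal |(D x).det| = ENNReal.ofReal |c| * volume (φ '' E) := by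
  obtain ⟨r, hrm, hr, hrt⟩ := exists_seq_strictMono_tendsto' hR
  have hrt' : ∀ n, closedBall y₀ (r n) ⊆ φ.target := fun n =>
    ht ▸ closedBall_subset_ball (hr n).2
  choose c hc1 hc2 hc3 using fun n => exists_area_formula φ hu hD (hr n).1 (hrt' n)
  have hcc : ∀ n, c n = c 0 := by
    intro n
    let b : ContDiffBump y₀ := ⟨r 0 / 4, r 0 / 2, by linarith [(hr 0).1], by linarith [(hr 0).1]⟩
    have hbs : tsupport b ⊆ ball y₀ (r 0) := by
      rw [b.tsupport_eq]; exact closedBall_subset_ball (half_lt_self (hr 0).1)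
    have h0 := hc1 0 b b.continuous b.hasCompactSupport hbs
    have hn := hc1 n b b.continuous b.hasCompactSupport
      (hbs.trans (ball_subset_ball (hrm.monotone (Nat.zero_le n))))
    exact mul_right_cancel₀ (b.integral_pos (μ := volume)).ne' (hn.symm.trans h0)
  simp_rw [hcc] at hc1 hc2 hc3
  have hcover : φ.source = ⋃ n, φ.source ∩ φ ⁻¹' ball y₀ (r n) := by
    refine Subset.antisymm (fun x hx => ?_) (iUnion_subset fun n => inter_subset_left)
    have h1 : dist (φ x) y₀ < R := by
      have := φ.map_source hx
      rwa [ht] at this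
    obtain ⟨n, hn⟩ := (hrt.eventually_const_lt h1).exists
    exact mem_iUnion.2 ⟨n, hx, hn⟩
  refine ⟨c 0, fun h0 => one_le_abs_of_area_formula φ hu hD (hr 0).1 (hrt' 0) h0 (hc1 0) (hc3 0),
    ?_, fun E hE hEs => ?_⟩
  · rw [hcover]
    exact (ae_restrict_iUnion_iff _ _).2 hc2
  · set F : ℕ → Set ℂ := fun n => E ∩ (φ.source ∩ φ ⁻¹' ball y₀ (r n)) with hF
    have hFm : ∀ n, MeasurableSet (F n) := fun n =>
      hE.inter (φ.isOpen_inter_preimage isOpen_ball).measurableSet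
    have hmono : Monotone F := fun i j hij => inter_subset_inter_right _
      (inter_subset_inter_right _ (preimage_mono (ball_subset_ball (hrm.monotone hij))))
    have hEF : E = ⋃ n, F n := by
      rw [hF, ← inter_iUnion, ← hcover, inter_eq_left.2 hEs]
    have t1 := tendsto_measure_iUnion_atTop
      (μ := volume.withDensity fun x => ENNReal.ofReal |(D x).det|) hmono
    have t2 := tendsto_measure_iUnion_atTop (μ := volume) (s := fun n => φ '' F n)
      (fun i j hij => image_mono (hmono hij))
    rw [← image_iUnion, ← hEF] at t2
    rw [← hEF, withDensity_apply _ hE] at t1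
    refine tendsto_nhds_unique t1 ((ENNReal.Tendsto.const_mul t2
      (Or.inr ENNReal.ofReal_ne_top)).congr fun n => ?_)
    simp only [Function.comp]
    rw [withDensity_apply _ (hFm n), hc3 n _ (hFm n) inter_subset_right]

/-- A vanishing weak differential makes both coordinates of `φ` almost everywhere constant on a
ball. Injectivity then squeezes almost all of the ball into one point. -/
theorem source_eq_empty_of_weakFDeriv_eq_zero (φ : OpenPartialHomeomorph ℂ ℂ)
    {D : ℂ → ℂ →L[ℝ] ℂ} (hu : HasWeakFDeriv φ.source φ D)
    (h0 : ∀ᵐ x ∂volume.restrict φ.source, D x = 0) : φ.source = ∅ := by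
  by_contra hne
  obtain ⟨x₀, hx₀⟩ := nonempty_iff_ne_empty.2 hne
  obtain ⟨r, hr, hrs⟩ := Metric.nhds_basis_closedBall.mem_iff.1 (φ.open_source.mem_nhds hx₀)
  have hbs : ball x₀ r ⊆ φ.source := ball_subset_closedBall.trans hrs
  have hφi : IntegrableOn φ (ball x₀ r) :=
    ((φ.continuousOn.mono hrs).integrableOn_compact (isCompact_closedBall x₀ r)).mono_set
      ball_subset_closedBall
  have key : ∀ ℓ : ℂ →L[ℝ] ℝ, ∃ c : ℝ, ∀ᵐ x ∂volume.restrict (ball x₀ r), ℓ (φ x) = c := by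
    intro ℓ
    have hi : IntegrableOn (fun x => ℓ (φ x)) (ball x₀ r) := ℓ.integrable_comp hφi
    -- With the identity in place of `u` and `ℓ ∘ φ` as density, the lemma says that a function with
    -- zero distributional gradient acts as a constant.
    obtain ⟨c, hc⟩ := exists_integral_comp_mul_eq_const_mul (m := volume.restrict (ball x₀ r))
      (u := id) aemeasurable_id hi hr fun G hG hGc hGB v => by
        have h1 := hu.integral_eq G hG hGc (hGB.trans hbs) v
        have h2 : ∫ x in φ.source, G x • D x v = 0 := by
          rw [integral_eq_zero_of_ae]
          filter_upwards [h0] with x hx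
          simp [hx]
        have hGv : tsupport (fun x => fderiv ℝ G x v) ⊆ tsupport G :=
          tsupport_fderiv_apply_subset ℝ v
        rw [h2, neg_zero, setIntegral_eq_of_subset_of_forall_sdiff_eq_zero
          φ.open_source.measurableSet hbs] at h1
        · have hint : IntegrableOn (fun x => fderiv ℝ G x v • φ x) (ball x₀ r) :=
            integrableOn_smul_of_locallyIntegrableOn isOpen_ball hφi.locallyIntegrableOn
              ((hG.continuous_fderiv (by simp)).clm_apply continuous_const)
              (hGc.fderiv_apply ℝ v) (hGv.trans hGB)
          have h3 := ℓ.integral_comp_comm hint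
          rw [h1, map_zero] at h3
          simpa only [map_smul, smul_eq_mul, id] using h3
        · intro x hx
          rw [image_eq_zero_of_notMem_tsupport fun h => hx.2 (hGB (hGv h)), zero_smul]
    refine ⟨c, (ae_restrict_iff' measurableSet_ball).2 ?_⟩
    have hloc : LocallyIntegrableOn (fun x => ℓ (φ x) - c) (ball x₀ r) := by
      refine IntegrableOn.locallyIntegrableOn (hi.sub ?_)
      exact integrableOn_const measure_ball_lt_top.ne
    refine (isOpen_ball.ae_eq_zero_of_integral_contDiff_smul_eq_zero hloc
      fun g hg hgc hgB => ?_).mono fun x hx hxB => sub_eq_zero.1 (hx hxB)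
    have h1 := hc g hg.continuous hgc hgB
    simp only [id] at h1
    rw [← setIntegral_eq_integral_of_forall_compl_eq_zero (s := ball x₀ r) fun y hy => by
      rw [image_eq_zero_of_notMem_tsupport fun h => hy (hgB h), zero_smul]]
    simp only [smul_eq_mul, mul_sub]
    have hgi : IntegrableOn (fun x => g x * ℓ (φ x)) (ball x₀ r) :=
      integrableOn_smul_of_locallyIntegrableOn isOpen_ball hi.locallyIntegrableOn
        hg.continuous hgc hgB
    rw [integral_sub hgi ((hg.continuous.integrable_of_hasCompactSupport hgc).integrableOn.mul_const
      c), h1, integral_mul_const, setIntegral_eq_integral_of_forall_compl_eq_zero fun y hy =>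
        image_eq_zero_of_notMem_tsupport fun h => hy (hgB h)]
    ring
  obtain ⟨a, ha⟩ := key Complex.reCLM
  obtain ⟨b, hb⟩ := key Complex.imCLM
  let z : ℂ := ⟨a, b⟩
  have hconst : ∀ᵐ x ∂volume.restrict (ball x₀ r), x = φ.symm z := by
    filter_upwards [ha, hb, ae_restrict_mem measurableSet_ball] with x h1 h2 hx
    have : φ x = z := Complex.ext h1 h2
    rw [← this, φ.left_inv (hbs hx)]
  have hne' : ∀ᵐ x ∂volume.restrict (ball x₀ r), x ≠ φ.symm z :=
    ae_restrict_of_ae (by simp [ae_iff])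
  have hz : volume.restrict (ball x₀ r) univ = 0 := by
    rw [Measure.measure_univ_eq_zero, ← ae_eq_bot, ← Filter.eventually_false_iff_eq_bot]
    filter_upwards [hconst, hne'] with x h1 h2 using h2 h1
  rw [Measure.restrict_apply_univ] at hz
  exact (measure_ball_pos volume x₀ hr).ne' hz

/-! ### Change of variables -/

/-- The density is `|J| / |c|`, written without absolute values as `c⁻¹ * J` so that the determinant
can later cancel against the one in `inv`. -/
theorem map_symm_restrict_target (φ : OpenPartialHomeomorph ℂ ℂ) {J : ℂ → ℝ} {c : ℝ} (hc : c ≠ 0)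
    (hJ : ∀ᵐ x ∂volume.restrict φ.source, 0 ≤ c * J x)
    (harea : ∀ E, MeasurableSet E → E ⊆ φ.source →
        ∫⁻ x in E, ENNReal.ofReal |J x| = ENNReal.ofReal |c| * volume (φ '' E)) :
    (volume.restrict φ.target).map φ.symm
      = (volume.restrict φ.source).withDensity fun x => ENNReal.ofReal (c⁻¹ * J x) := by
  have hm : AEMeasurable φ.symm (volume.restrict φ.target) :=
    φ.continuousOn_symm.aemeasurable φ.open_target.measurableSet
  ext S hS
  have hSs : MeasurableSet (φ.source ∩ S) := φ.open_source.measurableSet.inter hS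
  rw [Measure.map_apply_of_aemeasurable hm hS,
    Measure.restrict_apply' φ.open_target.measurableSet, inter_comm,
    ← φ.image_source_inter_eq', withDensity_apply _ hS, Measure.restrict_restrict hS,
    inter_comm S]
  have h1 := harea _ hSs inter_subset_left
  have h2 : ∫⁻ x in φ.source ∩ S, ENNReal.ofReal (c⁻¹ * J x)
      = ∫⁻ x in φ.source ∩ S, (ENNReal.ofReal |c|)⁻¹ * ENNReal.ofReal |J x| := by
    refine lintegral_congr_ae ?_
    filter_upwards [ae_restrict_of_ae_restrict_of_subset inter_subset_left hJ] with x hx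
    rw [← ENNReal.ofReal_inv_of_pos (abs_pos.2 hc), ← ENNReal.ofReal_mul (by positivity), ← abs_inv,
      ← abs_mul, abs_of_nonneg]
    have : c⁻¹ * J x = (c⁻¹) ^ 2 * (c * J x) := by field_simp
    rw [this]; positivity
  rw [h2, lintegral_const_mul' _ _ (by simp [hc]), h1, ← mul_assoc,
    ENNReal.inv_mul_cancel (by simp [hc]) ENNReal.ofReal_ne_top, one_mul]

theorem lintegral_target_comp_symm {φ : OpenPartialHomeomorph ℂ ℂ} {k : ℂ → ℝ}
    (hk : AEMeasurable k (volume.restrict φ.source))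
    (hmap : (volume.restrict φ.target).map φ.symm
      = (volume.restrict φ.source).withDensity fun x => ENNReal.ofReal (k x))
    {H : ℂ → ℝ≥0∞} (hH : AEMeasurable H (volume.restrict φ.source)) :
    ∫⁻ y in φ.target, H (φ.symm y) = ∫⁻ x in φ.source, ENNReal.ofReal (k x) * H x := by
  have hm : AEMeasurable φ.symm (volume.restrict φ.target) :=
    φ.continuousOn_symm.aemeasurable φ.open_target.measurableSet
  rw [← lintegral_map' (by rw [hmap]; exact hH.mono_ac (withDensity_absolutelyContinuous _ _)) hm,
    hmap, lintegral_withDensity_eq_lintegral_mul₀ hk.ennreal_ofReal hH]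
  rfl

/-- The push-forward of Lebesgue measure under `φ.symm` is absolutely continuous, so composition
respects modification on null sets. -/
theorem aestronglyMeasurable_comp_symm {φ : OpenPartialHomeomorph ℂ ℂ} {k : ℂ → ℝ}
    (hmap : (volume.restrict φ.target).map φ.symm
      = (volume.restrict φ.source).withDensity fun x => ENNReal.ofReal (k x))
    {E : Type*} [TopologicalSpace E] {H : ℂ → E}
    (hH : AEStronglyMeasurable H (volume.restrict φ.source)) :
    AEStronglyMeasurable (fun y => H (φ.symm y)) (volume.restrict φ.target) := by
  have hm : AEMeasurable φ.symm (volume.restrict φ.target) :=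
    φ.continuousOn_symm.aemeasurable φ.open_target.measurableSet
  refine AEStronglyMeasurable.comp_aemeasurable (g := H) ?_ hm
  rw [hmap]
  exact hH.mono_ac (withDensity_absolutelyContinuous _ _)

theorem integral_target_comp_symm {φ : OpenPartialHomeomorph ℂ ℂ} {k : ℂ → ℝ}
    (hk : AEMeasurable k (volume.restrict φ.source))
    (hk0 : ∀ᵐ x ∂volume.restrict φ.source, 0 ≤ k x)
    (hmap : (volume.restrict φ.target).map φ.symm
      = (volume.restrict φ.source).withDensity fun x => ENNReal.ofReal (k x))
    {E : Type*} [NormedAddCommGroup E] [NormedSpace ℝ E] {H : ℂ → E}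
    (hH : AEStronglyMeasurable H (volume.restrict φ.source)) :
    ∫ y in φ.target, H (φ.symm y) = ∫ x in φ.source, k x • H x := by
  have hm : AEMeasurable φ.symm (volume.restrict φ.target) :=
    φ.continuousOn_symm.aemeasurable φ.open_target.measurableSet
  rw [← integral_map hm (by rw [hmap]; exact hH.mono_ac (withDensity_absolutelyContinuous _ _)),
    hmap, integral_withDensity_eq_integral_toReal_smul₀ hk.ennreal_ofReal (by simp)]
  refine integral_congr_ae ?_
  filter_upwards [hk0] with x hx
  rw [ENNReal.toReal_ofReal hx]

/-! ### The inverse of a quasiconformal mapping -/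

/-- The inverse of a real-linear map of the plane, `0` if the determinant vanishes. -/
def inv (A : ℂ →L[ℝ] ℂ) : ℂ →L[ℝ] ℂ := A.det⁻¹ • adj A

theorem det_inv (A : ℂ →L[ℝ] ℂ) : (inv A).det = A.det⁻¹ := by
  rw [inv, det_smul', det_adj]
  by_cases h : A.det = 0
  · simp [h]
  · field_simp

/-- The inverse of a quasiconformal matrix is again quasiconformal. The factor `9` is the square of
the constant in `norm_adj_le`. -/
theorem abs_det_mul_norm_inv_sq_le {A : ℂ →L[ℝ] ℂ} {K : ℝ} (hK : 0 ≤ K)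
    (h : ‖A‖ ^ 2 ≤ K * |A.det|) : |A.det| * ‖inv A‖ ^ 2 ≤ 9 * K := by
  by_cases h0 : A.det = 0
  · simp only [h0, abs_zero, zero_mul]; positivity
  have hpos : 0 < |A.det| := abs_pos.2 h0
  have h1 : ‖inv A‖ ≤ |A.det|⁻¹ * (3 * ‖A‖) := by
    rw [inv, norm_smul, norm_inv, Real.norm_eq_abs]
    exact mul_le_mul_of_nonneg_left (norm_adj_le A) (by positivity)
  calc |A.det| * ‖inv A‖ ^ 2 ≤ |A.det| * (|A.det|⁻¹ * (3 * ‖A‖)) ^ 2 := by gcongr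
    _ = 9 * (|A.det|⁻¹ * ‖A‖ ^ 2) := by field_simp; ring
    _ ≤ 9 * (|A.det|⁻¹ * (K * |A.det|)) := by gcongr
    _ = 9 * K := by field_simp

theorem aestronglyMeasurable_inv {μ : Measure ℂ} {D : ℂ → ℂ →L[ℝ] ℂ}
    (hD : AEStronglyMeasurable D μ) : AEStronglyMeasurable (fun x => inv (D x)) μ := by
  have h1 : AEMeasurable (fun x => (D x).det) μ :=
    (continuous_det.comp_aestronglyMeasurable hD).aemeasurable
  exact h1.inv.aestronglyMeasurable.smul (continuous_adj.comp_aestronglyMeasurable hD)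

/-- Substitution turns the squared norm over `C` into an integral over the compact set `φ.symm ''
C`, with integrand at most `9 K / |c|` by the distortion inequality. -/
theorem memLp_inv_comp_symm {φ : OpenPartialHomeomorph ℂ ℂ} {D : ℂ → ℂ →L[ℝ] ℂ} {K c : ℝ}
    (hDm : AEStronglyMeasurable D (volume.restrict φ.source)) (hK : 0 ≤ K)
    (hdist : ∀ᵐ x ∂volume.restrict φ.source, ‖D x‖ ^ 2 ≤ K * |(D x).det|)
    (hmap : (volume.restrict φ.target).map φ.symm
      = (volume.restrict φ.source).withDensity fun x => ENNReal.ofReal (c⁻¹ * (D x).det))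
    {C : Set ℂ} (hC : IsCompact C) (hCt : C ⊆ φ.target) :
    MemLp (fun y => inv (D (φ.symm y))) 2 (volume.restrict C) := by
  have hkm : AEMeasurable (fun x => c⁻¹ * (D x).det) (volume.restrict φ.source) :=
    (continuous_det.comp_aestronglyMeasurable hDm).aemeasurable.const_mul _
  have hm := aestronglyMeasurable_comp_symm hmap (aestronglyMeasurable_inv hDm)
  refine ⟨hm.mono_set hCt, ?_⟩
  have hCs : IsCompact (φ.symm '' C) := hC.image_of_continuousOn (φ.continuousOn_symm.mono hCt)
  have hCss := symm_image_subset_source φ hCt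
  have hHm : AEMeasurable ((φ.symm '' C).indicator fun x => ‖inv (D x)‖ₑ ^ (2 : ℝ))
      (volume.restrict φ.source) :=
    ((aestronglyMeasurable_inv hDm).enorm.pow_const _).indicator hCs.measurableSet
  have h1 : ∫⁻ y in C, ‖inv (D (φ.symm y))‖ₑ ^ (2 : ℝ)
      = ∫⁻ y in φ.target, (φ.symm '' C).indicator (fun x => ‖inv (D x)‖ₑ ^ (2 : ℝ)) (φ.symm y) := by
    have hr : volume.restrict C = (volume.restrict φ.target).restrict C := by
      rw [Measure.restrict_restrict hC.measurableSet, inter_eq_left.2 hCt]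
    rw [hr, ← lintegral_indicator hC.measurableSet]
    refine setLIntegral_congr_fun φ.open_target.measurableSet fun y hy => ?_
    by_cases hyC : y ∈ C
    · have h2 : φ.symm y ∈ φ.symm '' C := ⟨y, hyC, rfl⟩
      rw [indicator_of_mem h2, indicator_of_mem hyC]
    · have h2 : φ.symm y ∉ φ.symm '' C := by
        rintro ⟨z, hz, hzy⟩
        exact hyC (φ.symm.injOn (hCt hz : z ∈ φ.symm.source) hy hzy ▸ hz)
      rw [indicator_of_notMem h2, indicator_of_notMem hyC]
  have h3 : eLpNorm (fun y => inv (D (φ.symm y))) 2 (volume.restrict C) ^ (2 : ℝ) < ⊤ := by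
    rw [eLpNorm_two_sq, h1, lintegral_target_comp_symm hkm hmap hHm]
    calc _ ≤ ∫⁻ x in φ.source, (φ.symm '' C).indicator
            (fun _ => ENNReal.ofReal (|c|⁻¹ * (9 * K))) x := by
          refine lintegral_mono_ae ?_
          filter_upwards [hdist] with x hx
          by_cases hxC : x ∈ φ.symm '' C
          · rw [indicator_of_mem hxC, indicator_of_mem hxC, ← ofReal_norm,
              ENNReal.ofReal_rpow_of_nonneg (norm_nonneg _) (by norm_num), Real.rpow_two,
              ← ENNReal.ofReal_mul' (by positivity)]
            refine ENNReal.ofReal_le_ofReal ?_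
            calc c⁻¹ * (D x).det * ‖inv (D x)‖ ^ 2
                ≤ |c⁻¹ * (D x).det| * ‖inv (D x)‖ ^ 2 := by gcongr; exact le_abs_self _
              _ = |c|⁻¹ * (|(D x).det| * ‖inv (D x)‖ ^ 2) := by rw [abs_mul, abs_inv]; ring
              _ ≤ |c|⁻¹ * (9 * K) :=
                mul_le_mul_of_nonneg_left (abs_det_mul_norm_inv_sq_le hK hx) (by positivity)
          · rw [indicator_of_notMem hxC, mul_zero]; exact zero_le
      _ = ENNReal.ofReal (|c|⁻¹ * (9 * K)) * volume (φ.symm '' C) := by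
          rw [lintegral_indicator hCs.measurableSet, setLIntegral_const,
            Measure.restrict_apply hCs.measurableSet, inter_eq_left.2 hCss]
      _ < ⊤ := ENNReal.mul_lt_top ENNReal.ofReal_lt_top hCs.measure_lt_top
  exact (ENNReal.rpow_lt_top_iff_of_pos (by norm_num)).1 h3

/-- The weights are linear functionals, equal to their own differential; the real and imaginary
parts together recover the vector identity. -/
theorem integral_det_mul_fderiv_comp_smul (φ : OpenPartialHomeomorph ℂ ℂ) {D : ℂ → ℂ →L[ℝ] ℂ}
    (hu : HasWeakFDeriv φ.source φ D)
    (hD : ∀ C : Set ℂ, IsCompact C → C ⊆ φ.source → MemLp D 2 (volume.restrict C))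
    {η : ℂ → ℝ} (hη : ContDiff ℝ ∞ η) (hηc : HasCompactSupport η) (hηt : tsupport η ⊆ φ.target)
    (v : ℂ) :
    ∫ x in φ.source, fderiv ℝ η (φ x) v • ((D x).det • x)
      = - ∫ x in φ.source, η (φ x) • adj (D x) v := by
  have hs := φ.open_source
  have hJ := locallyIntegrableOn_det hs hD
  have hJx : LocallyIntegrableOn (fun x => (D x).det • x) φ.source := by
    rw [locallyIntegrableOn_iff hs.isLocallyClosed] at hJ ⊢
    exact fun C hCs hC => (hJ C hCs hC).smul_continuousOn continuousOn_id hC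
  have hadj : LocallyIntegrableOn (fun x => adj (D x) v) φ.source := by
    rw [locallyIntegrableOn_iff hs.isLocallyClosed]
    intro C hCs hC
    have : IsFiniteMeasure (volume.restrict C) := isFiniteMeasure_restrict.2 hC.measure_lt_top.ne
    have hDC := hD C hC hCs
    refine ((hDC.integrable one_le_two).norm.const_mul (3 * ‖v‖)).mono' ?_
      (Eventually.of_forall fun x => ?_)
    · exact ((continuous_adj.clm_apply continuous_const).comp_aestronglyMeasurable hDC.1 :)
    · exact ((adj (D x)).le_of_opNorm_le (norm_adj_le _) v).trans_eq (by ring)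
  have hi1 : IntegrableOn (fun x => fderiv ℝ η (φ x) v • ((D x).det • x)) φ.source :=
    integrableOn_comp_smul φ (F := fun y => fderiv ℝ η y v)
      ((hη.continuous_fderiv (by simp)).clm_apply continuous_const)
      (hηc.fderiv_apply ℝ v) ((tsupport_fderiv_apply_subset ℝ v).trans hηt) hJx
  have hi2 : IntegrableOn (fun x => η (φ x) • adj (D x) v) φ.source :=
    integrableOn_comp_smul φ hη.continuous hηc hηt hadj
  have key : ∀ ℓ : ℂ →L[ℝ] ℝ, ℓ (∫ x in φ.source, fderiv ℝ η (φ x) v • ((D x).det • x))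
      = ℓ (- ∫ x in φ.source, η (φ x) • adj (D x) v) := by
    intro ℓ
    have h := integral_mul_det_mul_fderiv_comp φ hu hD hη hηc hηt (p := ℓ) ℓ.contDiff v
    rw [map_neg, ← ℓ.integral_comp_comm hi1, ← ℓ.integral_comp_comm hi2]
    simp only [map_smul, smul_eq_mul]
    simp only [ContinuousLinearMap.fderiv] at h
    rw [← h]
    refine integral_congr_ae (Eventually.of_forall fun x => ?_)
    simp only; ring
  exact Complex.ext (key Complex.reCLM) (key Complex.imCLM)

/-- The inverse of a quasiconformal mapping is weakly differentiable. -/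
theorem hasWeakFDeriv_symm (φ : OpenPartialHomeomorph ℂ ℂ) {D : ℂ → ℂ →L[ℝ] ℂ} {K c : ℝ}
    (hu : HasWeakFDeriv φ.source φ D)
    (hD : ∀ C : Set ℂ, IsCompact C → C ⊆ φ.source → MemLp D 2 (volume.restrict C)) (hK : 0 ≤ K)
    (hdist : ∀ᵐ x ∂volume.restrict φ.source, ‖D x‖ ^ 2 ≤ K * |(D x).det|) (hc : c ≠ 0)
    (hcJ : ∀ᵐ x ∂volume.restrict φ.source, 0 ≤ c * (D x).det)
    (hmap : (volume.restrict φ.target).map φ.symm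
      = (volume.restrict φ.source).withDensity fun x => ENNReal.ofReal (c⁻¹ * (D x).det)) :
    HasWeakFDeriv φ.target φ.symm (fun y => inv (D (φ.symm y))) := by
  have hDm : AEStronglyMeasurable D (volume.restrict φ.source) :=
    hu.locallyIntegrableOn_deriv.aestronglyMeasurable
  have hkm : AEMeasurable (fun x => c⁻¹ * (D x).det) (volume.restrict φ.source) :=
    (continuous_det.comp_aestronglyMeasurable hDm).aemeasurable.const_mul _
  have hk0 : ∀ᵐ x ∂volume.restrict φ.source, 0 ≤ c⁻¹ * (D x).det := by
    filter_upwards [hcJ] with x hx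
    have : c⁻¹ * (D x).det = (c⁻¹) ^ 2 * (c * (D x).det) := by field_simp
    rw [this]; positivity
  refine ⟨φ.continuousOn_symm.locallyIntegrableOn φ.open_target.measurableSet, ?_,
    fun η hη hηc hηt v => ?_⟩
  · rw [locallyIntegrableOn_iff φ.open_target.isLocallyClosed]
    intro C hCt hC
    have : IsFiniteMeasure (volume.restrict C) := isFiniteMeasure_restrict.2 hC.measure_lt_top.ne
    exact (memLp_inv_comp_symm hDm hK hdist hmap hC hCt).integrable one_le_two
  have hφm : ∀ {g : ℂ → ℝ}, Continuous g →
      AEStronglyMeasurable (fun x => g (φ x)) (volume.restrict φ.source) := fun hg =>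
    (hg.comp_continuousOn φ.continuousOn).aestronglyMeasurable φ.open_source.measurableSet
  have hη'c : Continuous fun y => fderiv ℝ η y v :=
    (hη.continuous_fderiv (by simp)).clm_apply continuous_const
  have e1 : ∫ y in φ.target, fderiv ℝ η y v • φ.symm y
      = ∫ x in φ.source, (c⁻¹ * (D x).det) • (fderiv ℝ η (φ x) v • x) := by
    rw [← integral_target_comp_symm (H := fun x => fderiv ℝ η (φ x) v • x) hkm hk0 hmap
      ((hφm hη'c).smul aestronglyMeasurable_id)]
    refine setIntegral_congr_fun φ.open_target.measurableSet fun y hy => ?_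
    simp only [φ.right_inv hy]
  have e2 : ∫ y in φ.target, η y • inv (D (φ.symm y)) v
      = ∫ x in φ.source, (c⁻¹ * (D x).det) • (η (φ x) • inv (D x) v) := by
    have hm : AEStronglyMeasurable (fun x => inv (D x) v) (volume.restrict φ.source) :=
      (aestronglyMeasurable_inv hDm).apply_continuousLinearMap v
    rw [← integral_target_comp_symm (H := fun x => η (φ x) • inv (D x) v) hkm hk0 hmap
      ((hφm hη.continuous).smul hm)]
    refine setIntegral_congr_fun φ.open_target.measurableSet fun y hy => ?_
    simp only [φ.right_inv hy]
  have e3 : ∫ x in φ.source, (c⁻¹ * (D x).det) • (fderiv ℝ η (φ x) v • x)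
      = c⁻¹ • ∫ x in φ.source, fderiv ℝ η (φ x) v • ((D x).det • x) := by
    rw [← integral_smul]
    refine integral_congr_ae (Eventually.of_forall fun x => ?_)
    simp only [smul_smul]; ring_nf
  have e4 : ∫ x in φ.source, (c⁻¹ * (D x).det) • (η (φ x) • inv (D x) v)
      = c⁻¹ • ∫ x in φ.source, η (φ x) • adj (D x) v := by
    rw [← integral_smul]
    refine integral_congr_ae ?_
    filter_upwards [hdist] with x hx
    -- On the degenerate set the distortion inequality gives `D x = 0`, so the adjugate vanishes too
    -- and the convention for `inv` costs nothing.
    by_cases h0 : (D x).det = 0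
    · have hD0 : D x = 0 := by
        rw [h0, abs_zero, mul_zero] at hx
        exact norm_eq_zero.1 (pow_eq_zero_iff (two_ne_zero) |>.1 (le_antisymm hx (by positivity)))
      have : adj (D x) v = 0 := by rw [hD0, adj_apply]; simp; rfl
      rw [this, h0]; simp
    · simp only [inv, smul_apply, smul_smul]
      congr 1
      field_simp
  rw [e1, e2, e3, e4, integral_det_mul_fderiv_comp_smul φ hu hD hη hηc hηt v, smul_neg]

/-- If `c = 0`, the Jacobian vanishes almost everywhere, and by distortion so does the whole
differential. -/
theorem ne_zero_of_area_formula (φ : OpenPartialHomeomorph ℂ ℂ) {D : ℂ → ℂ →L[ℝ] ℂ} {K c : ℝ}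
    (hu : HasWeakFDeriv φ.source φ D) (hne : φ.source.Nonempty)
    (hdist : ∀ᵐ x ∂volume.restrict φ.source, ‖D x‖ ^ 2 ≤ K * |(D x).det|)
    (harea : ∀ E, MeasurableSet E → E ⊆ φ.source →
      ∫⁻ x in E, ENNReal.ofReal |(D x).det| = ENNReal.ofReal |c| * volume (φ '' E)) :
    c ≠ 0 := by
  rintro rfl
  have hDm : AEStronglyMeasurable D (volume.restrict φ.source) :=
    hu.locallyIntegrableOn_deriv.aestronglyMeasurable
  have hm : AEMeasurable (fun x => ENNReal.ofReal |(D x).det|) (volume.restrict φ.source) :=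
    (continuous_abs.comp continuous_det).comp_aestronglyMeasurable hDm |>.aemeasurable.ennreal_ofReal
  have h := harea φ.source φ.open_source.measurableSet subset_rfl
  rw [abs_zero, ENNReal.ofReal_zero, zero_mul, lintegral_eq_zero_iff' hm] at h
  refine hne.ne_empty (source_eq_empty_of_weakFDeriv_eq_zero φ hu ?_)
  filter_upwards [h, hdist] with x hx hx'
  have h0 : |(D x).det| = 0 := le_antisymm (ENNReal.ofReal_eq_zero.1 hx) (abs_nonneg _)
  rw [h0, mul_zero] at hx'
  exact norm_eq_zero.1 (pow_eq_zero_iff two_ne_zero |>.1 (le_antisymm hx' (by positivity)))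

theorem setLIntegral_image_comp_symm {φ : OpenPartialHomeomorph ℂ ℂ} {k : ℂ → ℝ}
    (hk : AEMeasurable k (volume.restrict φ.source))
    (hmap : (volume.restrict φ.target).map φ.symm
      = (volume.restrict φ.source).withDensity fun x => ENNReal.ofReal (k x))
    {H : ℂ → ℝ≥0∞} (hH : AEMeasurable H (volume.restrict φ.source)) {S : Set ℂ}
    (hS : MeasurableSet S) (hSs : S ⊆ φ.source) :
    ∫⁻ y in φ '' S, H (φ.symm y) = ∫⁻ x in S, ENNReal.ofReal (k x) * H x := by
  have hT : MeasurableSet (φ '' S) :=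
    hS.image_of_continuousOn_injOn (φ.continuousOn.mono hSs) (φ.injOn.mono hSs)
  have hTt : φ '' S ⊆ φ.target := (φ.mapsTo.mono_left hSs).image_subset
  have hr : volume.restrict (φ '' S) = (volume.restrict φ.target).restrict (φ '' S) := by
    rw [Measure.restrict_restrict hT, inter_eq_left.2 hTt]
  have hr' : volume.restrict S = (volume.restrict φ.source).restrict S := by
    rw [Measure.restrict_restrict hS, inter_eq_left.2 hSs]
  rw [hr, hr', ← lintegral_indicator hT, ← lintegral_indicator hS]
  have h1 := lintegral_target_comp_symm hk hmap (hH.indicator hS)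
  calc _ = ∫⁻ y in φ.target, S.indicator H (φ.symm y) := by
        refine setLIntegral_congr_fun φ.open_target.measurableSet fun y hy => ?_
        by_cases hyS : φ.symm y ∈ S
        · have h2 : y ∈ φ '' S := ⟨_, hyS, φ.right_inv hy⟩
          rw [indicator_of_mem hyS, indicator_of_mem h2]
        · have h2 : y ∉ φ '' S := by
            rintro ⟨z, hz, rfl⟩
            exact hyS (by rwa [φ.left_inv (hSs hz)])
          rw [indicator_of_notMem hyS, indicator_of_notMem h2]
    _ = _ := by
        rw [h1]
        refine lintegral_congr fun x => ?_
        by_cases hx : x ∈ S <;> simp [hx]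

/-- The area formula for `φ⁻¹`, with constant `c'`, is pulled back to `x₀`'s neighbourhood. It says
that `c⁻¹ J · |J⁻¹|` equals `|c'|` almost everywhere, while this product is `|c|⁻¹` where `J ≠ 0`
and `0` elsewhere. -/
theorem exists_ball_ae_det_ne_zero (φ : OpenPartialHomeomorph ℂ ℂ) {D : ℂ → ℂ →L[ℝ] ℂ} {K c : ℝ}
    (hu : HasWeakFDeriv φ.source φ D)
    (hD : ∀ C : Set ℂ, IsCompact C → C ⊆ φ.source → MemLp D 2 (volume.restrict C)) (hK : 0 ≤ K)
    (hdist : ∀ᵐ x ∂volume.restrict φ.source, ‖D x‖ ^ 2 ≤ K * |(D x).det|) (hc : c ≠ 0)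
    (hcJ : ∀ᵐ x ∂volume.restrict φ.source, 0 ≤ c * (D x).det)
    (harea : ∀ E, MeasurableSet E → E ⊆ φ.source →
      ∫⁻ x in E, ENNReal.ofReal |(D x).det| = ENNReal.ofReal |c| * volume (φ '' E))
    {x₀ : ℂ} (hx₀ : x₀ ∈ φ.source) :
    |c| ≤ 1 ∧ ∃ r > 0, ∀ᵐ x ∂volume.restrict (ball x₀ r), (D x).det ≠ 0 := by
  have hDm : AEStronglyMeasurable D (volume.restrict φ.source) :=
    hu.locallyIntegrableOn_deriv.aestronglyMeasurable
  have hJm : AEMeasurable (fun x => (D x).det) (volume.restrict φ.source) :=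
    (continuous_det.comp_aestronglyMeasurable hDm).aemeasurable
  have hmap := map_symm_restrict_target φ hc hcJ harea
  have hu' := hasWeakFDeriv_symm φ hu hD hK hdist hc hcJ hmap
  obtain ⟨r, hr, hrs⟩ := Metric.nhds_basis_closedBall.mem_iff.1 (φ.open_source.mem_nhds hx₀)
  have hBs : ball x₀ r ⊆ φ.source := ball_subset_closedBall.trans hrs
  have hD' : ∀ C : Set ℂ, IsCompact C → C ⊆ φ.symm.source →
      MemLp (fun y => inv (D (φ.symm y))) 2 (volume.restrict C) :=
    fun C hC hCt => memLp_inv_comp_symm hDm hK hdist hmap hC hCt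
  obtain ⟨c', h1, -, h3⟩ := exists_area_formula φ.symm hu' hD' hr hrs
  have hkm : AEMeasurable (fun x => c⁻¹ * (D x).det) (volume.restrict φ.source) :=
    hJm.const_mul _
  have hHm : AEMeasurable (fun x => ENNReal.ofReal |(D x).det⁻¹|) (volume.restrict φ.source) :=
    hJm.inv.abs.ennreal_ofReal
  have key : ∀ S, MeasurableSet S → S ⊆ ball x₀ r →
      ∫⁻ x in S, ENNReal.ofReal (c⁻¹ * (D x).det) * ENNReal.ofReal |(D x).det⁻¹|
        = ENNReal.ofReal |c'| * volume S := by
    intro S hS hSB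
    have hSs := hSB.trans hBs
    have hT : MeasurableSet (φ '' S) :=
      hS.image_of_continuousOn_injOn (φ.continuousOn.mono hSs) (φ.injOn.mono hSs)
    have h := h3 (φ '' S) hT (by
      rintro _ ⟨x, hx, rfl⟩
      refine ⟨φ.mapsTo (hSs hx), ?_⟩
      rw [mem_preimage, φ.left_inv (hSs hx)]
      exact hSB hx)
    have himg : φ.symm '' (φ '' S) = S :=
      φ.toPartialEquiv.symm_image_image_of_subset_source hSs
    rw [himg] at h
    rw [← h, ← setLIntegral_image_comp_symm hkm hmap hHm hS hSs]
    simp only [det_inv]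
  have hrestr : volume.restrict (ball x₀ r) ≤ volume.restrict φ.source :=
    Measure.restrict_mono_set _ hBs
  have hae : ∀ᵐ x ∂volume.restrict (ball x₀ r),
      ENNReal.ofReal (c⁻¹ * (D x).det) * ENNReal.ofReal |(D x).det⁻¹| = ENNReal.ofReal |c'| := by
    refine ae_eq_of_forall_setLIntegral_eq_of_sigmaFinite₀
      ((hkm.ennreal_ofReal.mul hHm).mono_measure hrestr) aemeasurable_const fun S hS _ => ?_
    rw [Measure.restrict_restrict hS, setLIntegral_const]
    exact key _ (hS.inter measurableSet_ball) inter_subset_right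
  have hcJB := ae_mono hrestr hcJ
  have hval : ∀ᵐ x ∂volume.restrict (ball x₀ r), (D x).det ≠ 0 → |c|⁻¹ = |c'| := by
    filter_upwards [hae, hcJB] with x hx hx' h0
    rw [← ENNReal.ofReal_mul' (abs_nonneg _)] at hx
    have e : c⁻¹ * (D x).det * |(D x).det⁻¹| = |c|⁻¹ := by
      have e1 : c⁻¹ * (D x).det = |c|⁻¹ * |(D x).det| := by
        have : 0 ≤ c⁻¹ * (D x).det := by
          have : c⁻¹ * (D x).det = (c⁻¹) ^ 2 * (c * (D x).det) := by field_simp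
          rw [this]; positivity
        rw [← abs_of_nonneg this, abs_mul, abs_inv]
      rw [e1, abs_inv]
      field_simp
    rw [e] at hx
    exact (ENNReal.ofReal_eq_ofReal_iff (by positivity) (abs_nonneg _)).1 hx
  have hB0 : volume (ball x₀ r) ≠ 0 := (measure_ball_pos volume x₀ hr).ne'
  -- Otherwise `J = 0` almost everywhere on the ball, and the area formula for `φ` would make its
  -- open image null.
  have hc'0 : c' ≠ 0 := by
    rintro rfl
    have hz : ∀ᵐ x ∂volume.restrict (ball x₀ r), ENNReal.ofReal |(D x).det| = 0 := by
      filter_upwards [hval] with x hx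
      by_contra h0
      have : (D x).det ≠ 0 := fun h => h0 (by simp [h])
      have := hx this
      rw [abs_zero, inv_eq_zero, abs_eq_zero] at this
      exact hc this
    have h := harea _ measurableSet_ball hBs
    rw [lintegral_congr_ae hz, lintegral_zero] at h
    have hpos : 0 < volume (φ '' ball x₀ r) :=
      (φ.isOpen_image_of_subset_source isOpen_ball hBs).measure_pos _
        ((nonempty_ball.2 hr).image _)
    exact (mul_ne_zero (by simpa using hc) hpos.ne') h.symm
  have hne : ∀ᵐ x ∂volume.restrict (ball x₀ r), (D x).det ≠ 0 := by
    filter_upwards [hae] with x hx h0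
    rw [h0, mul_zero, ENNReal.ofReal_zero, zero_mul] at hx
    exact hc'0 (abs_eq_zero.1 (le_antisymm (ENNReal.ofReal_eq_zero.1 hx.symm) (abs_nonneg _)))
  refine ⟨?_, r, hr, hne⟩
  have hNB : (ae (volume.restrict (ball x₀ r))).NeBot :=
    ae_neBot.2 (Measure.restrict_eq_zero.not.2 hB0)
  obtain ⟨x, hx, hx'⟩ := (hval.and hne).exists
  -- The degree bound for the inverse reads `1 ≤ |c'| = |c|⁻¹`.
  have h4 := one_le_abs_of_area_formula φ.symm hu' hD' hr hrs hc'0 h1 h3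
  rw [← hx hx'] at h4
  exact (one_le_inv₀ (abs_pos.2 hc)).1 h4

/-- A quasiconformal mapping onto a disc satisfies the change of variables formula, its Jacobian
does not vanish, and its inverse is weakly differentiable, with the inverse differential. -/
theorem IsQuasiconformal.change_of_variables {K : ℝ} {φ : OpenPartialHomeomorph ℂ ℂ}
    (hφ : IsQuasiconformal K φ) {y₀ : ℂ} {R : ℝ} (hR : 0 < R) (ht : φ.target = ball y₀ R) :
    (∀ᵐ x ∂volume.restrict φ.source, jacobian φ.source φ x ≠ 0) ∧
    (volume.restrict φ.target).map φ.symm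
      = (volume.restrict φ.source).withDensity (fun x => ENNReal.ofReal |jacobian φ.source φ x|) ∧
    HasWeakFDeriv φ.target φ.symm (fun y => inv (weakFDeriv φ.source φ (φ.symm y))) := by
  have hw := hφ.memSobolevLoc.weaklyDifferentiableOn
  have hu : HasWeakFDeriv φ.source φ (weakFDeriv φ.source φ) := by
    rw [weakFDeriv, dif_pos hw]; exact hw.choose_spec
  have hD := hφ.memSobolevLoc.memLp_deriv
  have hK : 0 ≤ K := zero_le_one.trans hφ.one_le
  obtain ⟨c, hc1, hcJ, harea⟩ := exists_area_formula_of_target_eq_ball φ hu hD hR ht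
  obtain ⟨x₀, hx₀⟩ : φ.source.Nonempty :=
    ⟨_, φ.map_target (ht ▸ mem_ball_self hR : y₀ ∈ φ.target)⟩
  have hc := ne_zero_of_area_formula φ hu ⟨x₀, hx₀⟩ hφ.distortion harea
  have hball := fun {x : ℂ} (hx : x ∈ φ.source) =>
    exists_ball_ae_det_ne_zero φ hu hD hK hφ.distortion hc hcJ harea hx
  have hc' : |c| = 1 := le_antisymm (hball hx₀).1 (hc1 hc)
  have hmap := map_symm_restrict_target φ hc hcJ harea
  refine ⟨?_, ?_, hasWeakFDeriv_symm φ hu hD hK hφ.distortion hc hcJ hmap⟩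
  · rw [ae_restrict_iff' φ.open_source.measurableSet, ae_iff]
    -- Nonvanishing is known only near each point; second countability makes it global.
    refine measure_null_of_locally_null _ fun x hx => ?_
    simp only [mem_ofPred_eq, Classical.not_imp, not_not] at hx
    obtain ⟨-, r, hr, hae⟩ := hball hx.1
    refine ⟨_, inter_mem_nhdsWithin _ (ball_mem_nhds x hr), ?_⟩
    rw [ae_restrict_iff' measurableSet_ball, ae_iff] at hae
    refine measure_mono_null (fun z hz => ?_) hae
    simp only [mem_inter_iff, mem_ofPred_eq, Classical.not_imp, not_not] at hz ⊢
    exact ⟨hz.2, hz.1.2⟩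
  · rw [hmap]
    refine withDensity_congr_ae ?_
    filter_upwards [hcJ] with x hx
    have hcc : c * c = 1 := by rw [← abs_mul_abs_self, hc', one_mul]
    have hci : c⁻¹ = c := (eq_inv_of_mul_eq_one_left hcc).symm
    change _ = ENNReal.ofReal |(weakFDeriv φ.source φ x).det|
    rw [hci, ← abs_of_nonneg hx, abs_mul, hc', one_mul]

/-- Needed because `weakFDeriv` is an arbitrary choice, to be compared with the explicit
differential of the inverse. -/
theorem HasWeakFDeriv.ae_eq {U : Set ℂ} (hU : IsOpen U) {u : ℂ → ℂ} {D₁ D₂ : ℂ → ℂ →L[ℝ] ℂ}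
    (h₁ : HasWeakFDeriv U u D₁) (h₂ : HasWeakFDeriv U u D₂) :
    D₁ =ᵐ[volume.restrict U] D₂ := by
  have hloc : ∀ {D : ℂ → ℂ →L[ℝ] ℂ}, HasWeakFDeriv U u D → ∀ v,
      LocallyIntegrableOn (fun x => D x v) U := by
    intro D hD v
    have h := hD.locallyIntegrableOn_deriv
    rw [locallyIntegrableOn_iff hU.isLocallyClosed] at h ⊢
    exact fun C hC hCc => (h C hC hCc).apply_continuousLinearMap v
  have key : ∀ v : ℂ, ∀ᵐ x ∂volume.restrict U, D₁ x v = D₂ x v := by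
    intro v
    have h := hU.ae_eq_zero_of_integral_contDiff_smul_eq_zero
      (μ := volume) (f := fun x => D₁ x v - D₂ x v) ((hloc h₁ v).sub (hloc h₂ v))
      fun η hη hηc hηU => by
        have e₁ := h₁.integral_eq η hη hηc hηU v
        have e₂ := h₂.integral_eq η hη hηc hηU v
        have i₁ : IntegrableOn (fun x => η x • D₁ x v) U :=
          integrableOn_smul_of_locallyIntegrableOn hU (hloc h₁ v) hη.continuous hηc hηU
        have i₂ : IntegrableOn (fun x => η x • D₂ x v) U :=
          integrableOn_smul_of_locallyIntegrableOn hU (hloc h₂ v) hη.continuous hηc hηU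
        have hsupp : ∀ x, x ∉ U → η x • (D₁ x v - D₂ x v) = 0 := fun x hx => by
          rw [image_eq_zero_of_notMem_tsupport fun h => hx (hηU h), zero_smul]
        rw [← setIntegral_eq_integral_of_forall_compl_eq_zero hsupp]
        simp only [smul_sub]
        rw [integral_sub i₁ i₂, ← neg_inj.1 (e₁.symm.trans e₂), sub_self]
    rw [ae_restrict_iff' hU.measurableSet]
    filter_upwards [h] with x hx hxU using sub_eq_zero.1 (hx hxU)
  filter_upwards [key 1, key Complex.I] with x hx hx'
  ext v
  rw [clm_apply, hx, hx', ← clm_apply]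

/-! ### The embedding of the weighted Lebesgue space -/

/-- Insert `1 = |J| · |J⁻¹|`, which is legitimate as `J ≠ 0` almost everywhere, pass to the target,
apply Hölder there, and return the factor containing `f` to the source. -/
theorem lintegral_enorm_rpow_le {φ : OpenPartialHomeomorph ℂ ℂ} {J : ℂ → ℝ}
    (hJ : AEMeasurable J (volume.restrict φ.source))
    (hJ0 : ∀ᵐ x ∂volume.restrict φ.source, J x ≠ 0)
    (hmap : (volume.restrict φ.target).map φ.symm
      = (volume.restrict φ.source).withDensity fun x => ENNReal.ofReal |J x|)
    {f : ℂ → ℝ} (hf : AEStronglyMeasurable f (volume.restrict φ.source)) {p q s : ℝ}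
    (hpq : p.HolderConjugate q) :
    ∫⁻ x in φ.source, ‖f x‖ₑ ^ s ≤
      (∫⁻ x in φ.source, ENNReal.ofReal |J x| * ‖f x‖ₑ ^ (s * p)) ^ (1 / p) *
        (∫⁻ y in φ.target, ENNReal.ofReal |(J (φ.symm y))⁻¹| ^ q) ^ (1 / q) := by
  have hg : AEMeasurable (fun x => ENNReal.ofReal |(J x)⁻¹|) (volume.restrict φ.source) :=
    hJ.inv.abs.ennreal_ofReal
  have hfm : AEStronglyMeasurable (fun y => f (φ.symm y)) (volume.restrict φ.target) :=
    aestronglyMeasurable_comp_symm hmap hf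
  have hgm : AEMeasurable (fun y => ENNReal.ofReal |(J (φ.symm y))⁻¹|)
      (volume.restrict φ.target) :=
    (aestronglyMeasurable_comp_symm hmap hg.aestronglyMeasurable).aemeasurable
  calc ∫⁻ x in φ.source, ‖f x‖ₑ ^ s
      = ∫⁻ x in φ.source, ENNReal.ofReal |J x| * (‖f x‖ₑ ^ s * ENNReal.ofReal |(J x)⁻¹|) := by
        refine lintegral_congr_ae ?_
        filter_upwards [hJ0] with x hx
        rw [mul_left_comm, ← ENNReal.ofReal_mul (abs_nonneg _), abs_inv,
          mul_inv_cancel₀ (abs_ne_zero.2 hx), ENNReal.ofReal_one, mul_one]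
    _ = ∫⁻ y in φ.target, ‖f (φ.symm y)‖ₑ ^ s * ENNReal.ofReal |(J (φ.symm y))⁻¹| :=
        (lintegral_target_comp_symm hJ.abs hmap ((hf.enorm.pow_const s).mul hg)).symm
    _ ≤ (∫⁻ y in φ.target, (‖f (φ.symm y)‖ₑ ^ s) ^ p) ^ (1 / p) *
          (∫⁻ y in φ.target, ENNReal.ofReal |(J (φ.symm y))⁻¹| ^ q) ^ (1 / q) :=
        ENNReal.lintegral_mul_le_Lp_mul_Lq _ hpq (hfm.enorm.pow_const s) hgm
    _ = _ := by
        simp only [← ENNReal.rpow_mul]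
        rw [lintegral_target_comp_symm (H := fun x => ‖f x‖ₑ ^ (s * p)) hJ.abs hmap
          (hf.enorm.pow_const _)]

theorem IsRegularMap.ae_jacobian_symm_eq {K α : ℝ} {Ω : Set ℂ} {φ : OpenPartialHomeomorph ℂ ℂ}
    (hφ : IsRegularMap K α Ω φ) :
    ∀ᵐ y ∂volume.restrict unitDisc,
      jacobian unitDisc φ.symm y = (jacobian φ.source φ (φ.symm y))⁻¹ := by
  obtain ⟨-, -, hw⟩ := hφ.isQuasiconformal.change_of_variables one_pos hφ.target_eq
  rw [hφ.target_eq] at hw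
  have hwd : WeaklyDifferentiableOn unitDisc φ.symm := ⟨_, hw⟩
  have hw' : HasWeakFDeriv unitDisc φ.symm (weakFDeriv unitDisc φ.symm) := by
    rw [weakFDeriv, dif_pos hwd]; exact hwd.choose_spec
  filter_upwards [hw'.ae_eq isOpen_ball hw] with y hy
  rw [jacobian, hy, det_inv, jacobian]

end

end PlanarQC

theorem lemmaL2p3 (K α : ℝ) (Ω : Set ℂ) (hΩ : PlanarQC.IsRegularDomain K α Ω)
    (φ : OpenPartialHomeomorph ℂ ℂ) (hφ : PlanarQC.IsRegularMap K α Ω φ)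
    (h : ℂ → ℝ) (hh : ∀ x ∈ Ω, h x = |PlanarQC.jacobian Ω φ x|)
    (r s : ℝ) (hr : α / (α - 2) ≤ r) (hs : s = (α - 2) / α * r)
    (f : ℂ → ℝ) (hf : PlanarQC.MemWeightedLp r Ω h f) :
    MemLp f (ENNReal.ofReal s) (volume.restrict Ω) ∧
    eLpNorm f (ENNReal.ofReal s) (volume.restrict Ω) ≤
      PlanarQC.inverseJacobianIntegral α φ ^ (2 / α * (1 / s)) *
        PlanarQC.weightedNorm r Ω h f := by
  have hα := hΩ.two_lt
  have hα' : 0 < α - 2 := by linarith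
  have hr0 : 0 < r := lt_of_lt_of_le (by positivity) hr
  have hs0 : 0 < s := by rw [hs]; positivity
  have hsp : s * (α / (α - 2)) = r := by rw [hs]; field_simp
  -- The reciprocals `(α - 2) / α` and `2 / α` sum to `1`.
  have hpq : (α / (α - 2)).HolderConjugate (α / 2) := by
    rw [Real.holderConjugate_iff]
    refine ⟨by rw [one_lt_div hα']; linarith, ?_⟩
    field_simp
    ring
  suffices hle : eLpNorm f (ENNReal.ofReal s) (volume.restrict Ω) ≤
      PlanarQC.inverseJacobianIntegral α φ ^ (2 / α * (1 / s)) *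
        PlanarQC.weightedNorm r Ω h f from
    ⟨⟨hf.1, hle.trans_lt (ENNReal.mul_lt_top
      (ENNReal.rpow_lt_top_of_nonneg (by positivity) hφ.integral_lt_top.ne) hf.2)⟩, hle⟩
  obtain rfl := hφ.source_eq
  obtain ⟨hJ0, hmap, -⟩ :=
    hφ.isQuasiconformal.change_of_variables one_pos hφ.target_eq
  have hw := hφ.isQuasiconformal.memSobolevLoc.weaklyDifferentiableOn
  have hDm : AEStronglyMeasurable (PlanarQC.weakFDeriv φ.source φ)
      (volume.restrict φ.source) := by
    rw [PlanarQC.weakFDeriv, dif_pos hw]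
    exact hw.choose_spec.locallyIntegrableOn_deriv.aestronglyMeasurable
  have hJm : AEMeasurable (PlanarQC.jacobian φ.source φ) (volume.restrict φ.source) :=
    (PlanarQC.continuous_det.comp_aestronglyMeasurable hDm).aemeasurable
  have hmain := PlanarQC.lintegral_enorm_rpow_le hJm hJ0 hmap hf.1 (s := s) hpq
  have hW : ∫⁻ x in φ.source, ENNReal.ofReal |PlanarQC.jacobian φ.source φ x|
        * ‖f x‖ₑ ^ (s * (α / (α - 2)))
      = ∫⁻ x in φ.source, ENNReal.ofReal (|f x| ^ r * h x) := by
    refine setLIntegral_congr_fun φ.open_source.measurableSet fun x hx => ?_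
    rw [hsp, hh x hx, ENNReal.ofReal_mul (by positivity), mul_comm, Real.enorm_eq_ofReal_abs,
      ENNReal.ofReal_rpow_of_nonneg (abs_nonneg _) hr0.le]
  have hI : ∫⁻ y in φ.target,
        ENNReal.ofReal |(PlanarQC.jacobian φ.source φ (φ.symm y))⁻¹| ^ (α / 2)
      = PlanarQC.inverseJacobianIntegral α φ := by
    rw [hφ.target_eq, PlanarQC.inverseJacobianIntegral]
    refine lintegral_congr_ae ?_
    filter_upwards [hφ.ae_jacobian_symm_eq] with y hy
    rw [hy, ENNReal.ofReal_rpow_of_nonneg (abs_nonneg _) (by positivity)]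
  rw [hW, hI] at hmain
  rw [eLpNorm_eq_lintegral_rpow_enorm_toReal (by simpa using hs0) ENNReal.ofReal_ne_top,
    ENNReal.toReal_ofReal hs0.le]
  refine (ENNReal.rpow_le_rpow hmain (by positivity)).trans_eq ?_
  rw [ENNReal.mul_rpow_of_nonneg _ _ (by positivity), ← ENNReal.rpow_mul, ← ENNReal.rpow_mul,
    mul_comm, PlanarQC.weightedNorm, one_div_div]
  -- What remains is the exponent of the weighted integral: `(α - 2) / α · 1 / s = 1 / r`.
  congr 2
  rw [← hsp]
  field_simp
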